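/- **Conventions.** For $k\in\mathbb N$ let $\mathbb F_k$ be the free group of rank $k$. A $k$-marked group (a group with a generating $k$-tuple, up to isomorphism) is identified with the normal subgroup of $\mathbb F_k$ of its relations; $\mathcal G$ is the set of all marked groups, for all $k$. It is ordered by $(H,S')\le(G,S)$ iff both are marked by the same number of generators and $(H,S')$ is a marked quotient of $(G,S)$. Fix surjections $\theta_k:\mathbb N\to\mathbb F_k$. $\mathcal G$ is represented by the partial surjection $\rho_{\mathrm{WP}}$ from $\mathbb N^{\mathbb N}$ for which a name of the $k$-marked group with relation subgroup $N$ is the sequence $(k,\chi_N(\theta_k(0)),\chi_N(\theta_k(1)),\dots)$, where $\chi_N$ is the characteristic function of $N$. Let $\mathcal C$ be a set of finitely generated groups (considered up to isomorphism). A group $G$ is residually-$\mathcal C$ if every $g\ne1$ in $G$ has a non-trivial image in some quotient of $G$ that belongs to $\mathcal C$; $\mathcal{RC}\subseteq\mathcal G$ is the set of residually-$\mathcal C$ marked groups. $\mathrm{Res}_{\mathcal C}:\mathcal G\to\mathcal G$ maps $G$ to its greatest residually-$\mathcal C$ quotient $G/\bigcap\{\ker f\mid f:G\twoheadrightarrow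 H,\ H\in\mathcal C\}$, with the induced marking; both its domain and its codomain are represented by $\rho_{\mathrm{WP}}$. $\mathcal C$ is *equationally noetherian* if for all $n$ every system $\Sigma\subseteq\mathbb F_n$ has a finite subsystem $\Sigma_0\subseteq\Sigma$ such that, for every $G\in\mathcal C$, $\Sigma$ and $\Sigma_0$ have the same solutions in $G^n$. In a well-founded order $(A,\le)$, put $\mathrm{rank}(a)=\sup\{\mathrm{rank}(b)+1\mid b<a\}$; the ordinal rank of $A$ is $\sup\{\mathrm{rank}(a)+1\mid a\in A\}$. If $\mathcal C$ is equationally noetherian, then $\mathcal{RC}$ is well-founded for the order above. For a countable ordinal $\alpha\neq0$ and a surjection $f:\mathbb N\to\alpha$, the problem $\mathrm{Lim}_{\searrow\alpha}:\subseteq\mathbb N^{\mathbb N}\rightrightarrows\mathbb N$ has as domain the set of all $(u_n)$ with $f(u_{n+1})\le f(u_n)$ for all $n$, and maps such a sequence to $\{t\in\mathbb N\mid f(t)=\inf_n f(u_n)\}$. Here $\mathbb N^{\mathbb N}$ is represented by the identity, and a name of $t\in\mathbb N$ is a sequence with first term $t$. For partial multi-functions $P:\subseteq X\rightrightarrows Y$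 and $Q:\subseteq Z\rightrightarrows W$ between represented spaces, $P\le_W Q$ (continuous Weihrauch reduction) means that there are a represented space $V$ and multi-functions $k:\subseteq X\rightrightarrows V\times Z$ and $h:\subseteq V\times W\rightrightarrows Y$ with continuous realizers such that $R:=h\circ(\mathrm{id}_V\times Q)\circ k$ satisfies $\mathrm{dom}(P)\subseteq\mathrm{dom}(R)$ and $R(x)\subseteq P(x)$ for all $x\in\mathrm{dom}(P)$. $P\equiv_W Q$ means $P\le_WQ$ and $Q\le_WP$. **Theorem.** Let $\mathcal C$ be an equationally noetherian set of finitely generated groups, and let $\alpha$ be the ordinal rank of $\mathcal{RC}$. Then $\alpha$ is a non-zero countable ordinal, and, for any choice of the surjections used to define the problems $\mathrm{Lim}_{\searrow\alpha}$ and $\mathrm{Lim}_{\searrow\omega^\omega}$: * if $\alpha\le\omega^\omega$, then $\mathrm{Res}_{\mathcal C}\equiv_W\mathrm{Lim}_{\searrow\alpha}$; * if $\alpha>\omega^\omega$, then $\mathrm{Lim}_{\searrow\omega^\omega}\le_W\mathrm{Res}_{\mathcal C}\le_W\mathrm{Lim}_{\searrow\alpha}$. -/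

import Mathlib

universe u

/-! ### Represented spaces, multi-functions, continuous Weihrauch reduction -/

/-- A representation of `X`: a partial surjection `δ` from Baire space onto `X`, given by its
graph. `name p x` says that `p` lies in the domain of `δ` and `δ p = x`. -/
structure BaireRep (X : Type) where
  name : (ℕ → ℕ) → X → Prop
  unique : ∀ p x y, name p x → name p y → x = y
  surj : ∀ x, ∃ p, name p x

/-- A partial multi-function `f :⊆ X ⇉ Y`, that is, a relation viewed as `x ↦ f x ⊆ Y`. -/
abbrev MultiFun (X Y : Type) := X → Set Y

namespace MultiFun

/-- `dom f = {x | f x ≠ ∅}`. -/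
def dom {X Y : Type} (f : MultiFun X Y) : Set X := {x | (f x).Nonempty}

/-- Composition of multi-functions, with the usual domain `{x ∈ dom f | f x ⊆ dom g}`. -/
def comp {X Y Z : Type} (g : MultiFun Y Z) (f : MultiFun X Y) : MultiFun X Z :=
  fun x => {z | f x ⊆ g.dom ∧ ∃ y ∈ f x, z ∈ g y}

/-- The product `id_V × Q`. -/
def idProd (V : Type) {Z W : Type} (Q : MultiFun Z W) : MultiFun (V × Z) (V × W) :=
  fun a => {b | b.1 = a.1 ∧ b.2 ∈ Q a.2}

/-- `P₁` solves `P₂`. -/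
def Solves {X Y : Type} (P₁ P₂ : MultiFun X Y) : Prop :=
  P₂.dom ⊆ P₁.dom ∧ ∀ x ∈ P₂.dom, P₁ x ⊆ P₂ x

/-- `f` has a realizer `F :⊆ ℕ^ℕ → ℕ^ℕ` that is continuous on the set of all names of
points of `dom f`. (Values of `F` off this set are irrelevant.) -/
def ContinuouslyRealizable {X Y : Type} (ρ : BaireRep X) (τ : BaireRep Y)
    (f : MultiFun X Y) : Prop :=
  ∃ F : (ℕ → ℕ) → (ℕ → ℕ),
    ContinuousOn F {p | ∃ x ∈ f.dom, ρ.name p x} ∧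
    ∀ p, ∀ x ∈ f.dom, ρ.name p x → ∃ y ∈ f x, τ.name (F p) y

end MultiFun

namespace BaireRep

/-- The product representation: even digits name the first component, odd digits the second. -/
def prod {X Y : Type} (ρ : BaireRep X) (τ : BaireRep Y) : BaireRep (X × Y) where
  name p a := ρ.name (fun n => p (2 * n)) a.1 ∧ τ.name (fun n => p (2 * n + 1)) a.2
  unique p a b ha hb :=
    Prod.ext (ρ.unique _ _ _ ha.1 hb.1) (τ.unique _ _ _ ha.2 hb.2)
  surj a := by
    obtain ⟨p, hp⟩ := ρ.surj a.1
    obtain ⟨q, hq⟩ := τ.surj a.2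
    refine ⟨fun n => if n % 2 = 0 then p (n / 2) else q (n / 2), ?_, ?_⟩
    · have h : (fun n => if (2 * n) % 2 = 0 then p (2 * n / 2) else q (2 * n / 2)) = p := by
        funext n
        simp
      simpa only [h] using hp
    · have h : (fun n => if (2 * n + 1) % 2 = 0 then p ((2 * n + 1) / 2)
          else q ((2 * n + 1) / 2)) = q := by
        funext n
        have h1 : (2 * n + 1) % 2 ≠ 0 := by omega
        have h2 : (2 * n + 1) / 2 = n := by omega
        rw [if_neg h1, h2]
      simpa only [h] using hq

/-- Baire space, represented by the identity. -/
def baire : BaireRep (ℕ → ℕ) where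
  name p x := p = x
  unique _ _ _ h₁ h₂ := h₁.symm.trans h₂
  surj x := ⟨x, rfl⟩

/-- The discrete space `ℕ`: a name of `n` is a sequence whose first term is `n`. -/
def nat : BaireRep ℕ where
  name p n := p 0 = n
  unique _ _ _ h₁ h₂ := h₁.symm.trans h₂
  surj n := ⟨fun _ => n, rfl⟩

end BaireRep

/-- A problem: a partial multi-function between represented spaces. -/
structure WProblem where
  Inp : Type
  Out : Type
  inpRep : BaireRep Inp
  outRep : BaireRep Out
  toFun : MultiFun Inp Out

/-- `P ≤_W Q`: there are a represented space `V` and continuously realizable multi-functions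
`k :⊆ X ⇉ V × Z` and `h :⊆ V × W ⇉ Y` such that `h ∘ (id_V × Q) ∘ k` solves `P`, where
`P :⊆ X ⇉ Y` and `Q :⊆ Z ⇉ W`. -/
def WeihrauchLE (P Q : WProblem) : Prop :=
  ∃ (V : Type) (ν : BaireRep V)
    (h : MultiFun (V × Q.Out) P.Out) (k : MultiFun P.Inp (V × Q.Inp)),
    h.ContinuouslyRealizable (ν.prod Q.outRep) P.outRep ∧
    k.ContinuouslyRealizable P.inpRep (ν.prod Q.inpRep) ∧
    (h.comp ((MultiFun.idProd V Q.toFun).comp k)).Solves P.toFun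

/-- `P ≡_W Q`. -/
def WeihrauchEquiv (P Q : WProblem) : Prop := WeihrauchLE P Q ∧ WeihrauchLE Q P

/-! ### Limits of weakly descending sequences of ordinals -/

/-- `f` is a surjection of `ℕ` onto the ordinal `α = {β | β < α}`. -/
def EnumeratesOrdinal (f : ℕ → Ordinal.{0}) (α : Ordinal.{0}) : Prop :=
  Set.range f = Set.Iio α

/-- The problem `Lim_{↘(α,f)} :⊆ ℕ^ℕ ⇉ ℕ`, for `f` an enumeration of the ordinal `α`. Its domain
consists of the `u` with `f (u (n+1)) ≤ f (u n)` for all `n`, and its solutions on `u` are the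
`t` with `f t = inf_n f (u n)`. -/
noncomputable def limDescending (f : ℕ → Ordinal.{0}) : WProblem where
  Inp := ℕ → ℕ
  Out := ℕ
  inpRep := BaireRep.baire
  outRep := BaireRep.nat
  toFun u := {t | (∀ n, f (u (n + 1)) ≤ f (u n)) ∧ f t = ⨅ n, f (u n)}

/-! ### Marked groups -/

/-- A `k`-marked group up to isomorphism, identified with the normal subgroup of its relations
in the free group of rank `k`. It stands for the quotient group, generated by the images of the
`k` free generators. -/
@[ext]
structure KMarkedGroup (k : ℕ) where
  rels : Subgroup (FreeGroup (Fin k))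
  normal : rels.Normal

instance {k : ℕ} (G : KMarkedGroup k) : G.rels.Normal := G.normal

/-- The underlying group of a `k`-marked group. -/
abbrev KMarkedGroup.Carrier {k : ℕ} (G : KMarkedGroup k) : Type := FreeGroup (Fin k) ⧸ G.rels

/-- `H ≤ G` when `H` is a marked quotient of `G`, i.e. when `H` satisfies all relations
of `G`. -/
instance (k : ℕ) : PartialOrder (KMarkedGroup k) where
  le H G := G.rels ≤ H.rels
  le_refl _ := le_refl _
  le_trans _ _ _ h₁ h₂ := le_trans h₂ h₁
  le_antisymm _ _ h₁ h₂ := KMarkedGroup.ext (le_antisymm h₂ h₁)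

/-- Marked groups, for all `k`. The order is that of the disjoint union: `H ≤ G` when `H` and `G`
are marked by the same number of generators and `H` is a marked quotient of `G`. -/
abbrev MarkedGroup : Type := Σ k : ℕ, KMarkedGroup k

/-- The word problem representation `ρ_WP`, for enumerations `θ k` of the free groups: a name
of a `k`-marked group is `k` followed by the characteristic sequence of its set of relations. -/
def wpRep (θ : ∀ k : ℕ, ℕ → FreeGroup (Fin k)) (hθ : ∀ k, Function.Surjective (θ k)) :
    BaireRep MarkedGroup where
  name p G := p 0 = G.1 ∧ ∀ i, (p (i + 1) = 1 ∧ θ G.1 i ∈ G.2.rels) ∨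
    (p (i + 1) = 0 ∧ θ G.1 i ∉ G.2.rels)
  unique := by
    rintro p ⟨k, G⟩ ⟨l, H⟩ ⟨h₁, h₂⟩ ⟨h₃, h₄⟩
    obtain rfl : k = l := h₁.symm.trans h₃
    congr 1
    ext w
    obtain ⟨i, rfl⟩ := hθ k w
    have a := h₂ i
    have b := h₄ i
    simp only at a b
    constructor
    · intro hw
      rcases a with a | a
      · rcases b with b | b
        · exact b.2
        · omega
      · exact absurd hw a.2
    · intro hw
      rcases b with b | b
      · rcases a with a | a
        · exact a.2
        · omega
      · exact absurd hw b.2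
  surj := by
    classical
    rintro ⟨k, G⟩
    refine ⟨fun n => Nat.casesOn n k fun i => if θ k i ∈ G.rels then 1 else 0, rfl, fun i => ?_⟩
    by_cases h : θ k i ∈ G.rels <;> simp [h]

/-! ### Residual properties -/

/-- `G` is residually-`C`: every `g ≠ 1` has a non-trivial image in some quotient of `G` that
belongs to `C`. -/
def IsResidually (C : Set GrpCat.{u}) (G : Type) [Group G] : Prop :=
  ∀ g : G, g ≠ 1 → ∃ H ∈ C, ∃ f : G →* H, Function.Surjective f ∧ f g ≠ 1

/-- The intersection of the kernels of all surjective morphisms from `G` to groups of `C`. -/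
def residualSubgroup (C : Set GrpCat.{u}) (G : Type) [Group G] : Subgroup G :=
  ⨅ (H : GrpCat.{u}) (_ : H ∈ C) (f : G →* H) (_ : Function.Surjective f), f.ker

theorem residualSubgroup_normal (C : Set GrpCat.{u}) (G : Type) [Group G] :
    (residualSubgroup C G).Normal := by
  unfold residualSubgroup
  refine Subgroup.normal_iInf_normal fun H => Subgroup.normal_iInf_normal fun _ =>
    Subgroup.normal_iInf_normal fun f => Subgroup.normal_iInf_normal fun _ => f.normal_ker

/-- `Res_C`: the marked group obtained from `G` by dividing out `residualSubgroup C G`. Its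
relations are the words whose image in `G` lies in that subgroup. -/
def resMarked (C : Set GrpCat.{u}) (G : MarkedGroup) : MarkedGroup :=
  ⟨G.1,
    { rels := (residualSubgroup C G.2.Carrier).comap (QuotientGroup.mk' G.2.rels)
      normal := (residualSubgroup_normal C G.2.Carrier).comap _ }⟩

/-- `Res_C` as a problem, from the space of marked groups to itself. -/
def resProblem (θ : ∀ k : ℕ, ℕ → FreeGroup (Fin k)) (hθ : ∀ k, Function.Surjective (θ k))
    (C : Set GrpCat.{u}) : WProblem where
  Inp := MarkedGroup
  Out := MarkedGroup
  inpRep := wpRep θ hθ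
  outRep := wpRep θ hθ
  toFun G := {resMarked C G}

/-- The set `RC` of residually-`C` marked groups, with the order induced from `MarkedGroup`. -/
def residuallyMarked (C : Set GrpCat.{u}) : Set MarkedGroup :=
  {G | IsResidually C G.2.Carrier}

/-! ### Equational noetherianity and the rank -/

/-- The algebraic set `V_Sys(C)`: all tuples in groups of `C` that solve every equation
of `Sys`. -/
def algebraicSet (C : Set GrpCat.{u}) {n : ℕ} (Sys : Set (FreeGroup (Fin n))) :
    Set (Σ G : GrpCat.{u}, (Fin n → G)) :=
  {x | x.1 ∈ C ∧ ∀ W ∈ Sys, FreeGroup.lift x.2 W = 1}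

/-- `C` is equationally noetherian: over `C`, every system of equations in finitely many unknowns
is equivalent to a finite subsystem. -/
def EquationallyNoetherian (C : Set GrpCat.{u}) : Prop :=
  ∀ (n : ℕ) (Sys : Set (FreeGroup (Fin n))), ∃ Sys₀ ⊆ Sys, Sys₀.Finite ∧
    algebraicSet C Sys = algebraicSet C Sys₀

/-- The ordinal rank `sup {rank a + 1 | a ∈ A}` of a well-founded order. Here
`IsWellFounded.rank (· < ·) a` is the supremum of `rank b + 1` over all `b < a`. -/
noncomputable def orderRank (A : Type) [PartialOrder A] [WellFoundedLT A] : Ordinal.{0} :=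
  ⨆ a : A, Order.succ (IsWellFounded.rank (α := A) (· < ·) a)

theorem EquationallyNoetherian.wellFoundedLT {C : Set GrpCat.{u}}
    (hC : EquationallyNoetherian C) : WellFoundedLT (residuallyMarked C) := by
  refine ⟨wellFounded_iff_isEmpty_descending_chain.2 ⟨?_⟩⟩
  rintro ⟨f, hf⟩
  obtain ⟨k, hk⟩ : ∃ k, k = (f 0).1.1 := ⟨_, rfl⟩
  have key : ∀ n, ∃ N : KMarkedGroup k, (f n).1 = ⟨k, N⟩ := by
    intro n
    have hn : (f n).1.1 = k := by
      induction n with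
      | zero => exact hk.symm
      | succ n ih =>
        obtain ⟨h, -⟩ := Sigma.lt_def.1 (show (f (n + 1)).1 < (f n).1 from hf n)
        exact h.trans ih
    generalize (f n).1 = x at hn
    obtain ⟨l, N⟩ := x
    obtain rfl : l = k := hn
    exact ⟨N, rfl⟩
  choose N hN using key
  have hlt : ∀ n, N (n + 1) < N n := by
    intro n
    have h : (f (n + 1)).1 < (f n).1 := hf n
    rw [hN, hN] at h
    exact Sigma.mk_lt_mk_iff.1 h
  have hmono : Monotone fun n => (N n).rels := monotone_nat_of_le_succ fun n => (hlt n).le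
  obtain ⟨S, hS, hfin, hV⟩ := hC k (⋃ n, ((N n).rels : Set (FreeGroup (Fin k))))
  obtain ⟨I, hI, hSI⟩ := Set.finite_subset_iUnion hfin hS
  obtain ⟨m, hmI⟩ := hI.bddAbove
  have hm : S ⊆ (N m).rels := fun v hv => by
    obtain ⟨n, hn, hvn⟩ := Set.mem_iUnion₂.1 (hSI hv)
    exact hmono (hmI hn) hvn
  refine (hlt m).not_ge fun w hw => ?_
  by_contra hwm
  have hres : IsResidually C (N m).Carrier := by
    have h : (f m).1 ∈ residuallyMarked C := (f m).2
    rw [hN] at h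
    exact h
  obtain ⟨H, hH, φ, -, hφ⟩ := hres (QuotientGroup.mk' (N m).rels w)
    (fun h => hwm ((QuotientGroup.eq_one_iff w).1 h))
  have hlift : ∀ v, FreeGroup.lift (fun i => φ (QuotientGroup.mk' (N m).rels (FreeGroup.of i))) v
      = φ (QuotientGroup.mk' (N m).rels v) := by
    intro v
    have : FreeGroup.lift (fun i => φ (QuotientGroup.mk' (N m).rels (FreeGroup.of i)))
        = φ.comp (QuotientGroup.mk' (N m).rels) := by
      ext i
      simp
    rw [this]
    rfl
  have hmem : (⟨H, fun i => φ (QuotientGroup.mk' (N m).rels (FreeGroup.of i))⟩ :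
      Σ G : GrpCat.{u}, (Fin k → G)) ∈ algebraicSet C S := by
    refine ⟨hH, fun W hW => ?_⟩
    have h1 : QuotientGroup.mk' (N m).rels W = 1 := (QuotientGroup.eq_one_iff W).2 (hm hW)
    exact (hlift W).trans (by rw [h1, map_one])
  rw [← hV] at hmem
  exact hφ ((hlift w).symm.trans (hmem.2 w (Set.mem_iUnion.2 ⟨m + 1, hw⟩)))

/-- The ordinal rank of `RC`, for `C` equationally noetherian. -/
noncomputable def residualRank (C : Set GrpCat.{u}) (hC : EquationallyNoetherian C) :
    Ordinal.{0} :=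
  haveI := hC.wellFoundedLT
  orderRank (residuallyMarked C)

/-!
# The residual quotient and limits of descending ordinals

Both reductions hold for the whole rank `α` of the residually-`C` marked groups, with no condition
on `α`: `resProblem_le_limDescending` reduces the residual quotient to limits of weakly descending
sequences below `α`, and `limDescending_le_resProblem` reduces limits of such sequences, for any
enumeration of ordinals below `α`, to the residual quotient.

**From groups to ordinals.** A name of a marked group `G` enumerates its relators. The residual
quotients of the groups presented by the first `n` relators form a descending sequence in a
well-founded order, so their ranks descend. By equational noetherianity this sequence reaches the
residual quotient of `G`, and it has done so exactly when the rank has become minimal.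

**From ordinals to groups.** Given `c : ℤ → F_k`, let `y` act on the free group on
`x_1, …, x_k, z_m` (`m ∈ ℤ`) by the transvection `z_m ↦ c_m z_m`, and let `t` shift the `z_m`. In
the semidirect product with the free group on `t` and `y`, the commutator of `y` and
`t ^ j z_0 t ^ (-j)` is `c_j` (`commutatorMarking_commutatorWord`). Three facts make the group
marked by `x_1, …, x_k, z_0, t, y` useful.

* Whether a word is a relation depends on finitely many of the `c_m`
  (`finitelyDetermined_mem_rels`), so the marked group depends continuously on `c`. In particular
  it may be altered by changing `c_m` for large `m`.
* Over `C`, finitely many of the commutators imply all of them. If `c` is trivial on these finitely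
  many positions, the residual quotient therefore satisfies all relations `c_j = 1`
  (`EquationallyNoetherian.exists_bound`), although the group itself does not.
* Killing `z_0, t, y` maps the group onto every group that satisfies all relations `c_m = 1`, so
  the residual quotient satisfies no more relations among the `x_i` than it must
  (`radical_commutatorMarked_le`).

A descending sequence `b` of ordinals is followed by a descending sequence of residually-`C`
groups `G_n` with `b n < rank G_n` (unless `b n = 0`). For each of them a quotient of rank at least
`b n` and a word `d_n` that is trivial there but not in `G_n` are fixed in advance. When `b`
descends, one passes to the quotient, whose rank exceeds the new ordinal, and `d_n` is appended
to `c`. Then `d_n` dies in the residual quotient of the encoding group if and only if `b` descends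
after time `n`, which allows the limit of `b` to be found. A group of rank above a given non-zero
ordinal below `α` exists since adding a generator raises the rank of a non-trivial group
(`exists_lt_residuallyRank`).
-/

/-! ### Weihrauch reductions by realizers -/

/-- Two points of Baire space whose first `m` digits coincide. -/
def AgreeBelow (m : ℕ) (p q : ℕ → ℕ) : Prop := ∀ j < m, q j = p j

theorem AgreeBelow.mono {m n : ℕ} {p q : ℕ → ℕ} (h : AgreeBelow n p q) (hmn : m ≤ n) :
    AgreeBelow m p q := fun j hj => h j (hj.trans_le hmn)

/-- A map of Baire space is continuous if each digit of its values is determined by finitely many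
digits of the argument. -/
theorem continuousOn_baire {F : (ℕ → ℕ) → (ℕ → ℕ)} {S : Set (ℕ → ℕ)}
    (h : ∀ p ∈ S, ∀ i, ∃ m, ∀ q ∈ S, AgreeBelow m p q → F q i = F p i) : ContinuousOn F S := by
  rw [continuousOn_pi]
  intro i p hp
  obtain ⟨m, hm⟩ := h p hp i
  have hev : ∀ᶠ q in nhds p, AgreeBelow m p q := by
    have : ∀ᶠ q in nhds p, ∀ j ∈ Finset.range m, q j = p j := by
      rw [Filter.eventually_all_finset]
      intro j _
      have hc : Filter.Tendsto (fun q : ℕ → ℕ => q j) (nhds p) (nhds (p j)) :=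
        (continuous_apply j).continuousAt
      rw [nhds_discrete ℕ] at hc
      exact Filter.tendsto_pure.1 hc
    filter_upwards [this] with q hq j hj using hq j (Finset.mem_range.2 hj)
  refine (continuousWithinAt_const (b := F p i)).congr_of_eventuallyEq ?_ rfl
  filter_upwards [nhdsWithin_le_nhds hev, self_mem_nhdsWithin] with q hq hqS using hm q hqS hq

/-- The point of Baire space with even digits `p` and odd digits `q`. -/
def interleave (p q : ℕ → ℕ) : ℕ → ℕ := fun n => if n % 2 = 0 then p (n / 2) else q (n / 2)

theorem interleave_even (p q : ℕ → ℕ) (n : ℕ) : interleave p q (2 * n) = p n := by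
  simp [interleave]

theorem interleave_odd (p q : ℕ → ℕ) (n : ℕ) : interleave p q (2 * n + 1) = q n := by
  have h1 : (2 * n + 1) % 2 ≠ 0 := by omega
  have h2 : (2 * n + 1) / 2 = n := by omega
  rw [interleave, if_neg h1, h2]

/-- A Weihrauch reduction given by two maps of Baire space: `K` turns a name of an input of `P`
into a name of an input of `Q`, and `D` turns the original name together with a name of a solution
of `Q` into a name of a solution of `P`. The auxiliary space `V` is Baire space, through which
the original name is passed on. -/
theorem weihrauchLE_of_realizers {P Q : WProblem} (K : (ℕ → ℕ) → (ℕ → ℕ))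
    (D : (ℕ → ℕ) → (ℕ → ℕ) → (ℕ → ℕ))
    (hK : ∀ p, ∀ x ∈ P.toFun.dom, P.inpRep.name p x → ∃ z ∈ Q.toFun.dom, Q.inpRep.name (K p) z)
    (hKc : ∀ p, (∃ x ∈ P.toFun.dom, P.inpRep.name p x) → ∀ i, ∃ m,
      ∀ p', (∃ x ∈ P.toFun.dom, P.inpRep.name p' x) → AgreeBelow m p p' → K p' i = K p i)
    (hD : ∀ p, ∀ x ∈ P.toFun.dom, P.inpRep.name p x → ∀ z, Q.inpRep.name (K p) z →
      ∀ w ∈ Q.toFun z, ∀ q, Q.outRep.name q w → ∃ y ∈ P.toFun x, P.outRep.name (D p q) y)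
    (hDc : ∀ p q, ∀ x ∈ P.toFun.dom, P.inpRep.name p x → ∀ z, Q.inpRep.name (K p) z →
      ∀ w ∈ Q.toFun z, Q.outRep.name q w → ∃ m, ∀ p' q',
        (∃ x ∈ P.toFun.dom, P.inpRep.name p' x) → AgreeBelow m p p' → AgreeBelow m q q' →
        D p' q' = D p q) : WeihrauchLE P Q := by
  let k : MultiFun P.Inp ((ℕ → ℕ) × Q.Inp) := fun x =>
    {a | x ∈ P.toFun.dom ∧ P.inpRep.name a.1 x ∧ a.2 ∈ Q.toFun.dom ∧ Q.inpRep.name (K a.1) a.2}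
  let h : MultiFun ((ℕ → ℕ) × Q.Out) P.Out := fun b =>
    {y | ∃ x ∈ P.toFun.dom, P.inpRep.name b.1 x ∧ y ∈ P.toFun x ∧
      ∃ z, Q.inpRep.name (K b.1) z ∧ b.2 ∈ Q.toFun z}
  have hkdom : ∀ x ∈ P.toFun.dom, (k x).Nonempty := by
    intro x hx
    obtain ⟨p, hp⟩ := P.inpRep.surj x
    obtain ⟨z, hz, hz'⟩ := hK p x hx hp
    exact ⟨(p, z), hx, hp, hz, hz'⟩
  have hhdom : ∀ x, ∀ a ∈ k x, ∀ w ∈ Q.toFun a.2, (a.1, w) ∈ h.dom := by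
    rintro x a ⟨hx, hp, hz, hz'⟩ w hw
    obtain ⟨y, hy⟩ := id hx
    exact ⟨y, x, hx, hp, hy, a.2, hz', hw⟩
  refine ⟨ℕ → ℕ, BaireRep.baire, h, k, ?_, ?_, ?_, ?_⟩
  · refine ⟨fun r => D (fun n => r (2 * n)) (fun n => r (2 * n + 1)), continuousOn_baire ?_, ?_⟩
    · rintro r ⟨⟨p, w⟩, ⟨y, x, hx, hp, hy, z, hz, hw⟩, hr1, hr2⟩ i
      change (fun n => r (2 * n)) = p at hr1
      subst hr1
      obtain ⟨m, hm⟩ := hDc _ _ x hx hp z hz w hw hr2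
      refine ⟨2 * m + 1, ?_⟩
      rintro r' ⟨⟨p', w'⟩, ⟨y', x', hx', hp', -⟩, hr1', -⟩ hrr
      change (fun n => r' (2 * n)) = p' at hr1'
      subst hr1'
      exact congrFun (hm _ _ ⟨x', hx', hp'⟩ (fun j hj => hrr _ (by omega))
        (fun j hj => hrr _ (by omega))) i
    · rintro r ⟨p, w⟩ ⟨y, x, hx, hp, hy, z, hz, hw⟩ ⟨hr1, hr2⟩
      change (fun n => r (2 * n)) = p at hr1
      subst hr1
      obtain ⟨y', hy', hn⟩ := hD _ x hx hp z hz w hw _ hr2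
      exact ⟨y', ⟨x, hx, hp, hy', z, hz, hw⟩, hn⟩
  · have hdom : ∀ x ∈ k.dom, x ∈ P.toFun.dom := by
      rintro x ⟨a, ha⟩
      exact ha.1
    refine ⟨fun p => interleave p (K p), continuousOn_baire ?_, ?_⟩
    · rintro p ⟨x, hx, hp⟩ i
      obtain ⟨m, hm⟩ := hKc p ⟨x, hdom x hx, hp⟩ (i / 2)
      refine ⟨m + i + 1, ?_⟩
      rintro p' ⟨x', hx', hp'⟩ hpp
      have h1 := hm p' ⟨x', hdom x' hx', hp'⟩ (hpp.mono (by omega))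
      have h2 := hpp (i / 2) (by omega)
      simp only [interleave, h1, h2]
    · intro p x hx hp
      obtain ⟨z, hz, hz'⟩ := hK p x (hdom x hx) hp
      refine ⟨(p, z), ⟨hdom x hx, hp, hz, hz'⟩, ?_, ?_⟩
      · change (fun n => interleave p (K p) (2 * n)) = p
        exact funext fun n => interleave_even _ _ n
      · change Q.inpRep.name (fun n => interleave p (K p) (2 * n + 1)) z
        simpa only [interleave_odd] using hz'
  · intro x hx
    have hcomp : ∀ b ∈ ((MultiFun.idProd (ℕ → ℕ) Q.toFun).comp k) x,
        ∃ a ∈ k x, ∃ w ∈ Q.toFun a.2, b = (a.1, w) := by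
      rintro ⟨b1, b2⟩ ⟨-, a, ha, hb1, hb2⟩
      exact ⟨a, ha, b2, hb2, Prod.ext hb1 rfl⟩
    obtain ⟨a, ha⟩ := hkdom x hx
    obtain ⟨w, hw⟩ := id ha.2.2.1
    obtain ⟨y, hy⟩ := hhdom x a ha w hw
    refine ⟨y, ?_, (a.1, w), ⟨?_, a, ha, rfl, hw⟩, hy⟩
    · intro b hb
      obtain ⟨a, ha, w, hw, rfl⟩ := hcomp b hb
      exact hhdom x a ha w hw
    · rintro a ⟨-, -, ⟨w, hw⟩, -⟩
      exact ⟨(a.1, w), rfl, hw⟩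
  · rintro x hx y ⟨-, b, ⟨-, a, ha, hb1, hb2⟩, x', hx', hp', hy, -⟩
    have : x' = x := P.inpRep.unique _ _ _ hp' (by rw [hb1]; exact ha.2.1)
    rwa [← this]

open Classical in
/-- The canonical name of a marked group for the word problem representation. -/
noncomputable def wpName (θ : ∀ k : ℕ, ℕ → FreeGroup (Fin k)) (G : MarkedGroup) : ℕ → ℕ
  | 0 => G.1
  | i + 1 => if θ G.1 i ∈ G.2.rels then 1 else 0

theorem name_wpName (θ : ∀ k : ℕ, ℕ → FreeGroup (Fin k)) (hθ : ∀ k, Function.Surjective (θ k))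
    (G : MarkedGroup) : (wpRep θ hθ).name (wpName θ G) G := by
  refine ⟨rfl, fun i => ?_⟩
  by_cases h : θ G.1 i ∈ G.2.rels <;> simp [wpName, h]

theorem wpRep_digit_eq_one {θ : ∀ k : ℕ, ℕ → FreeGroup (Fin k)}
    {hθ : ∀ k, Function.Surjective (θ k)} {p : ℕ → ℕ} {G : MarkedGroup}
    (h : (wpRep θ hθ).name p G) (i : ℕ) : p (i + 1) = 1 ↔ θ G.1 i ∈ G.2.rels := by
  rcases h.2 i with h | h
  · simp [h]
  · simp [h.1, h.2]

theorem wpRep_digit_eq_zero {θ : ∀ k : ℕ, ℕ → FreeGroup (Fin k)}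
    {hθ : ∀ k, Function.Surjective (θ k)} {p : ℕ → ℕ} {G : MarkedGroup}
    (h : (wpRep θ hθ).name p G) (i : ℕ) : p (i + 1) = 0 ↔ θ G.1 i ∉ G.2.rels := by
  rcases h.2 i with h | h
  · simp [h]
  · simp [h.1, h.2]

/-! ### Relations implied over `C` -/

section Radical

variable {C : Set GrpCat.{u}} {k : ℕ}

/-- The words in `k` letters that are killed by every surjection of the free group onto a group
of `C` that kills `S`. -/
def radical (C : Set GrpCat.{u}) {k : ℕ} (S : Set (FreeGroup (Fin k))) :
    Subgroup (FreeGroup (Fin k)) :=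
  ⨅ (H : GrpCat.{u}) (_ : H ∈ C) (f : FreeGroup (Fin k) →* H) (_ : Function.Surjective f)
    (_ : ∀ s ∈ S, f s = 1), f.ker

theorem mem_radical {S : Set (FreeGroup (Fin k))} {w : FreeGroup (Fin k)} :
    w ∈ radical C S ↔ ∀ H ∈ C, ∀ f : FreeGroup (Fin k) →* H, Function.Surjective f →
      (∀ s ∈ S, f s = 1) → f w = 1 := by
  simp only [radical, Subgroup.mem_iInf, MonoidHom.mem_ker]

theorem radical_normal (C : Set GrpCat.{u}) (S : Set (FreeGroup (Fin k))) :
    (radical C S).Normal := by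
  refine ⟨fun w hw g => mem_radical.2 fun H hH f hf hS => ?_⟩
  simp [mem_radical.1 hw H hH f hf hS]

theorem subset_radical (C : Set GrpCat.{u}) (S : Set (FreeGroup (Fin k))) :
    S ⊆ radical C S :=
  fun s hs => mem_radical.2 fun _ _ _ _ hS => hS s hs

theorem radical_le_radical {S T : Set (FreeGroup (Fin k))} (h : S ⊆ radical C T) :
    radical C S ≤ radical C T :=
  fun _ hw => mem_radical.2 fun H hH f hf hT =>
    mem_radical.1 hw H hH f hf fun _ hs => mem_radical.1 (h hs) H hH f hf hT

theorem radical_mono {S T : Set (FreeGroup (Fin k))} (h : S ⊆ T) :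
    radical C S ≤ radical C T :=
  radical_le_radical (h.trans (subset_radical C T))

/-- The largest residually-`C` marked group in `k` generators satisfying the relations `S`. -/
def radicalMarked (C : Set GrpCat.{u}) (S : Set (FreeGroup (Fin k))) : KMarkedGroup k :=
  ⟨radical C S, radical_normal C S⟩

theorem resMarked_eq (G : KMarkedGroup k) :
    resMarked C ⟨k, G⟩ = ⟨k, radicalMarked C (G.rels : Set (FreeGroup (Fin k)))⟩ := by
  refine Sigma.ext rfl (heq_of_eq (KMarkedGroup.ext (Subgroup.ext fun w => ?_)))
  change QuotientGroup.mk' G.rels w ∈ residualSubgroup C G.Carrier ↔ w ∈ radical C _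
  refine Iff.trans ?_ (mem_radical (C := C) (k := k)).symm
  simp only [residualSubgroup, Subgroup.mem_iInf, MonoidHom.mem_ker]
  constructor
  · intro h H hH f hf hG
    refine h H hH (QuotientGroup.lift G.rels f hG) fun y => ?_
    obtain ⟨x, rfl⟩ := hf y
    exact ⟨QuotientGroup.mk' G.rels x, rfl⟩
  · intro h H hH f hf
    refine h H hH (f.comp (QuotientGroup.mk' G.rels))
      (hf.comp (QuotientGroup.mk'_surjective _)) fun s hs => ?_
    have : QuotientGroup.mk' G.rels s = 1 := (QuotientGroup.eq_one_iff s).2 hs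
    rw [MonoidHom.comp_apply, this, map_one]

/-- Residuality in terms of words and surjections of the free group. -/
theorem isResidually_iff {G : KMarkedGroup k} :
    IsResidually C G.Carrier ↔ ∀ w ∉ G.rels, ∃ H ∈ C, ∃ f : FreeGroup (Fin k) →* H,
      Function.Surjective f ∧ (∀ s ∈ G.rels, f s = 1) ∧ f w ≠ 1 := by
  constructor
  · intro h w hw
    obtain ⟨H, hH, f, hf, hfw⟩ := h (QuotientGroup.mk' G.rels w)
      fun h => hw ((QuotientGroup.eq_one_iff w).1 h)
    refine ⟨H, hH, f.comp (QuotientGroup.mk' G.rels),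
      hf.comp (QuotientGroup.mk'_surjective _), fun s hs => ?_, hfw⟩
    have : QuotientGroup.mk' G.rels s = 1 := (QuotientGroup.eq_one_iff s).2 hs
    rw [MonoidHom.comp_apply, this, map_one]
  · intro h g hg
    obtain ⟨w, rfl⟩ := QuotientGroup.mk'_surjective G.rels g
    obtain ⟨H, hH, f, hf, hG, hfw⟩ := h w fun h => hg ((QuotientGroup.eq_one_iff w).2 h)
    refine ⟨H, hH, QuotientGroup.lift G.rels f hG, fun y => ?_, hfw⟩
    obtain ⟨x, rfl⟩ := hf y
    exact ⟨QuotientGroup.mk' G.rels x, rfl⟩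

theorem isResidually_iff_radical_le {G : KMarkedGroup k} :
    IsResidually C G.Carrier ↔ radical C (G.rels : Set (FreeGroup (Fin k))) ≤ G.rels := by
  rw [isResidually_iff]
  constructor
  · intro h w hw
    by_contra hwG
    obtain ⟨H, hH, f, hf, hG, hfw⟩ := h w hwG
    exact hfw (mem_radical.1 hw H hH f hf hG)
  · intro h w hw
    have hw' : w ∉ radical C (G.rels : Set (FreeGroup (Fin k))) := fun h' => hw (h h')
    simp only [mem_radical, not_forall] at hw'
    obtain ⟨H, hH, f, hf, hG, hfw⟩ := hw'
    exact ⟨H, hH, f, hf, hG, hfw⟩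

theorem isResidually_radicalMarked (S : Set (FreeGroup (Fin k))) :
    IsResidually C (radicalMarked C S).Carrier :=
  isResidually_iff_radical_le.2 (radical_le_radical subset_rfl)

/-- Equational noetherianity in terms of homomorphisms. These need not be surjective, which is
what makes a consequence in `n` letters usable inside a larger free group. -/
theorem EquationallyNoetherian.exists_finite (hC : EquationallyNoetherian C)
    (S : Set (FreeGroup (Fin k))) : ∃ S₀ ⊆ S, S₀.Finite ∧ ∀ H ∈ C,
      ∀ f : FreeGroup (Fin k) →* H, (∀ s ∈ S₀, f s = 1) → ∀ s ∈ S, f s = 1 := by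
  obtain ⟨S₀, hS₀, hfin, hV⟩ := hC k S
  refine ⟨S₀, hS₀, hfin, fun H hH f hf s hs => ?_⟩
  have hlift : FreeGroup.lift (fun i => f (FreeGroup.of i)) = f := by
    ext i
    simp
  have hmem : (⟨H, fun i => f (FreeGroup.of i)⟩ : Σ G : GrpCat.{u}, (Fin k → G)) ∈
      algebraicSet C S₀ := ⟨hH, fun W hW => by rw [hlift]; exact hf W hW⟩
  rw [← hV] at hmem
  have := hmem.2 s hs
  rwa [hlift] at this

theorem EquationallyNoetherian.exists_finite_radical (hC : EquationallyNoetherian C)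
    (S : Set (FreeGroup (Fin k))) : ∃ S₀ ⊆ S, S₀.Finite ∧ radical C S₀ = radical C S := by
  obtain ⟨S₀, hS₀, hfin, h⟩ := hC.exists_finite S
  refine ⟨S₀, hS₀, hfin, le_antisymm (radical_mono hS₀) ?_⟩
  exact radical_le_radical fun s hs => mem_radical.2 fun H hH f _ hf => h H hH f hf s hs

end Radical

/-! ### The rank function of the residually-`C` marked groups -/

section Rank

variable {C : Set GrpCat.{u}}

/-- The rank of a residually-`C` marked group in the well-founded order on these groups. -/
noncomputable def residuallyRank (hC : EquationallyNoetherian C) (G : residuallyMarked C) :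
    Ordinal.{0} :=
  haveI := hC.wellFoundedLT
  IsWellFounded.rank (α := residuallyMarked C) (· < ·) G

theorem residuallyRank_strictMono (hC : EquationallyNoetherian C) :
    StrictMono (residuallyRank hC) :=
  have := hC.wellFoundedLT
  WellFoundedLT.rank_strictMono

theorem lt_residuallyRank (hC : EquationallyNoetherian C) {G : residuallyMarked C}
    {β : Ordinal.{0}} : β < residuallyRank hC G ↔ ∃ H < G, β ≤ residuallyRank hC H := by
  have := hC.wellFoundedLT
  rw [residuallyRank, IsWellFounded.rank_eq, Ordinal.lt_iSup_iff]
  simp only [Order.lt_succ_iff, Subtype.exists, exists_prop]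
  rfl

theorem lt_residualRank (hC : EquationallyNoetherian C) {β : Ordinal.{0}} :
    β < residualRank C hC ↔ ∃ G : residuallyMarked C, β ≤ residuallyRank hC G := by
  rw [residualRank, orderRank, Ordinal.lt_iSup_iff]
  simp only [Order.lt_succ_iff]
  rfl

theorem residuallyRank_lt (hC : EquationallyNoetherian C) (G : residuallyMarked C) :
    residuallyRank hC G < residualRank C hC :=
  (lt_residualRank hC).2 ⟨G, le_rfl⟩

/-- The ranks form an initial segment of the ordinals. -/
theorem range_residuallyRank (hC : EquationallyNoetherian C) :
    Set.range (residuallyRank hC) = Set.Iio (residualRank C hC) := by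
  ext β
  constructor
  · rintro ⟨G, rfl⟩
    exact residuallyRank_lt hC G
  · intro h
    have := hC.wellFoundedLT
    obtain ⟨G, hG⟩ := (lt_residualRank hC).1 h
    exact IsWellFounded.mem_range_rank_of_le hG

/-- The residually-`C` marked group generated by `k` elements subject to the relations `S`. -/
def radicalPoint (C : Set GrpCat.{u}) (k : ℕ) (S : Set (FreeGroup (Fin k))) :
    residuallyMarked C :=
  ⟨⟨k, radicalMarked C S⟩, isResidually_radicalMarked S⟩

theorem radicalPoint_le {k : ℕ} {S T : Set (FreeGroup (Fin k))}
    (h : radical C T ≤ radical C S) : radicalPoint C k S ≤ radicalPoint C k T :=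
  Sigma.mk_le_mk_iff.2 h

theorem eq_radicalPoint :
    ∀ G : residuallyMarked C, G = radicalPoint C G.1.1 (G.1.2.rels : Set (FreeGroup (Fin G.1.1))) := by
  rintro ⟨⟨k, G⟩, hG⟩
  refine Subtype.ext (Sigma.ext rfl (heq_of_eq (KMarkedGroup.ext ?_)))
  exact le_antisymm (subset_radical C _) (isResidually_iff_radical_le.1 hG)

/-- A residually-`C` marked group is determined by finitely many of its relations. -/
theorem countable_residuallyMarked (hC : EquationallyNoetherian C) :
    Countable (residuallyMarked C) := by
  have : ∀ k, Countable (FreeGroup (Fin k)) := fun k =>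
    (Quot.mk_surjective : Function.Surjective (Quot.mk (@FreeGroup.Red.Step (Fin k)))).countable
  let F : (Σ k : ℕ, Finset (FreeGroup (Fin k))) → residuallyMarked C :=
    fun x => radicalPoint C x.1 (x.2 : Set (FreeGroup (Fin x.1)))
  refine Function.Surjective.countable (f := F) fun G => ?_
  rw [eq_radicalPoint G]
  obtain ⟨S₀, -, hfin, hS⟩ := hC.exists_finite_radical (G.1.2.rels : Set (FreeGroup (Fin G.1.1)))
  refine ⟨⟨G.1.1, hfin.toFinset⟩, le_antisymm (radicalPoint_le ?_) (radicalPoint_le ?_)⟩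
  · rw [hfin.coe_toFinset, hS]
  · rw [hfin.coe_toFinset, hS]

theorem residualRank_pos (hC : EquationallyNoetherian C) : 0 < residualRank C hC :=
  (lt_residualRank hC).2 ⟨radicalPoint C 0 ∅, bot_le⟩

theorem exists_enumeratesOrdinal (hC : EquationallyNoetherian C) {β : Ordinal.{0}} (h0 : 0 < β)
    (hβ : β ≤ residualRank C hC) : ∃ f, EnumeratesOrdinal f β := by
  have := countable_residuallyMarked hC
  have hcount : (Set.Iio β).Countable := by
    refine Set.Countable.mono (Set.Iio_subset_Iio hβ) ?_
    rw [← range_residuallyRank hC]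
    exact Set.countable_range _
  obtain ⟨f, hf⟩ := hcount.exists_eq_range ⟨0, h0⟩
  exact ⟨f, hf.symm⟩

end Rank

/-! ### Reducing the residual quotient to limits of descending ordinals -/

section Upper

variable {C : Set GrpCat.{u}} (θ : ∀ k : ℕ, ℕ → FreeGroup (Fin k))

/-- The relators announced by the first `n` digits of a name `p` of a `p 0`-marked group. -/
def relatorsBelow (p : ℕ → ℕ) (n : ℕ) : Set (FreeGroup (Fin (p 0))) :=
  θ (p 0) '' {i | i < n ∧ p (i + 1) = 1}

/-- The residually-`C` group presented by the relators announced by the first `n` digits. -/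
def stage (C : Set GrpCat.{u}) (p : ℕ → ℕ) (n : ℕ) : residuallyMarked C :=
  radicalPoint C (p 0) (relatorsBelow θ p n)

theorem stage_congr {p q : ℕ → ℕ} {n : ℕ} (h : AgreeBelow (n + 1) p q) :
    stage θ C q n = stage θ C p n := by
  have h0 : q 0 = p 0 := h 0 n.succ_pos
  have hI : {i | i < n ∧ q (i + 1) = 1} = {i | i < n ∧ p (i + 1) = 1} := by
    ext i
    simp only [Set.mem_ofPred_eq, and_congr_right_iff]
    intro hi
    rw [h (i + 1) (by omega)]
  unfold stage relatorsBelow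
  rw [hI, h0]

theorem stage_antitone (p : ℕ → ℕ) : Antitone (stage θ C p) := fun _ _ hmn =>
  radicalPoint_le (radical_mono (Set.image_mono fun _ hi => ⟨hi.1.trans_le hmn, hi.2⟩))

variable {θ} {hθ : ∀ k, Function.Surjective (θ k)}

theorem resMarked_le_stage {p : ℕ → ℕ} {G : MarkedGroup} (hp : (wpRep θ hθ).name p G) (n : ℕ) :
    resMarked C G ≤ (stage θ C p n).1 := by
  have hdigit := wpRep_digit_eq_one hp
  obtain ⟨k, G⟩ := G
  obtain ⟨rfl, -⟩ := id hp
  rw [resMarked_eq]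
  refine Sigma.mk_le_mk_iff.2 (radical_mono ?_)
  rintro _ ⟨i, hi, rfl⟩
  exact (hdigit i).1 hi.2

/-- By equational noetherianity, finitely many relators of `G` determine its residual quotient. -/
theorem exists_stage_eq_resMarked (hC : EquationallyNoetherian C) {p : ℕ → ℕ} {G : MarkedGroup}
    (hp : (wpRep θ hθ).name p G) : ∃ n, (stage θ C p n).1 = resMarked C G := by
  have hle := resMarked_le_stage (C := C) hp
  have hdigit := wpRep_digit_eq_one hp
  obtain ⟨k, G⟩ := G
  obtain ⟨rfl, -⟩ := id hp
  obtain ⟨S₀, hS₀, hfin, hS⟩ :=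
    hC.exists_finite_radical (G.rels : Set (FreeGroup (Fin (p 0))))
  choose idx hidx using hθ (p 0)
  obtain ⟨n, hn⟩ := (hfin.image idx).bddAbove
  refine ⟨n + 1, le_antisymm ?_ (hle _)⟩
  rw [resMarked_eq]
  refine Sigma.mk_le_mk_iff.2 ?_
  change radical C _ ≤ radical C _
  rw [← hS]
  refine radical_mono fun w hw => ⟨idx w, ⟨?_, ?_⟩, hidx w⟩
  · exact Nat.lt_succ_of_le (hn ⟨w, hw, rfl⟩)
  · rw [hdigit, hidx]
    exact hS₀ hw

variable (hC : EquationallyNoetherian C)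

/-- The least value of the ranks of the stages identifies the stage that has reached the residual
quotient: a strictly larger stage would have strictly larger rank. -/
theorem stage_eq_resMarked_iff {p : ℕ → ℕ} {G : MarkedGroup} (hp : (wpRep θ hθ).name p G)
    (n : ℕ) : (stage θ C p n).1 = resMarked C G ↔
      residuallyRank hC (stage θ C p n) = ⨅ m, residuallyRank hC (stage θ C p m) := by
  obtain ⟨N, hN⟩ := exists_stage_eq_resMarked (hθ := hθ) hC hp
  have hle : ∀ m, stage θ C p N ≤ stage θ C p m := fun m => by
    change (stage θ C p N).1 ≤ (stage θ C p m).1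
    rw [hN]
    exact resMarked_le_stage hp m
  have hmono := (residuallyRank_strictMono hC).monotone
  have hinf : ⨅ m, residuallyRank hC (stage θ C p m) = residuallyRank hC (stage θ C p N) :=
    le_antisymm (ciInf_le' _ N) (le_ciInf fun m => hmono (hle m))
  rw [hinf, ← hN]
  constructor
  · intro h
    rw [Subtype.ext h]
  · intro h
    rcases (hle n).eq_or_lt with h' | h'
    · rw [h']
    · exact absurd h (residuallyRank_strictMono hC h').ne'

/-- The relators of `G` are read off its name, and the ranks of the residual quotients of the
resulting finitely presented groups form the descending sequence. Its limit tells which of these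
quotients is the final one. -/
theorem resProblem_le_limDescending {f : ℕ → Ordinal.{0}}
    (hf : EnumeratesOrdinal f (residualRank C hC)) :
    WeihrauchLE (resProblem θ hθ C) (limDescending f) := by
  have hidx : ∀ G, ∃ n, f n = residuallyRank hC G := fun G => by
    have : residuallyRank hC G ∈ Set.range f := by
      rw [hf]
      exact residuallyRank_lt hC G
    exact this
  choose idx hidx using hidx
  let K : (ℕ → ℕ) → (ℕ → ℕ) := fun p n => idx (stage θ C p n)
  have hfK : ∀ p n, f (K p n) = residuallyRank hC (stage θ C p n) := fun p n => hidx _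
  let first : (ℕ → ℕ) → ℕ → ℕ := fun p t =>
    sInf {n | f t = residuallyRank hC (stage θ C p n)}
  let D : (ℕ → ℕ) → (ℕ → ℕ) → (ℕ → ℕ) := fun p q =>
    wpName θ (stage θ C p (first p (q 0))).1
  -- Validity of an answer `t` means that some stage has rank `f t`, and that this is the minimum.
  have hfirst : ∀ p G, (wpRep θ hθ).name p G → ∀ t, f t = ⨅ n, f (K p n) →
      f t = residuallyRank hC (stage θ C p (first p t)) := by
    intro p G hp t ht
    refine Nat.sInf_mem (s := {n | f t = residuallyRank hC (stage θ C p n)}) ?_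
    obtain ⟨N, hN⟩ := exists_stage_eq_resMarked (hθ := hθ) hC hp
    refine ⟨N, ?_⟩
    rw [Set.mem_ofPred_eq, (stage_eq_resMarked_iff (hθ := hθ) hC hp N).1 hN, ht]
    simp only [hfK]
  refine weihrauchLE_of_realizers K D ?_ ?_ ?_ ?_
  · rintro p G - hp
    have hdesc : ∀ n, f (K p (n + 1)) ≤ f (K p n) := fun n => by
      rw [hfK, hfK]
      exact (residuallyRank_strictMono hC).monotone (stage_antitone θ p n.le_succ)
    obtain ⟨N, hN⟩ := exists_stage_eq_resMarked (hθ := hθ) hC hp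
    refine ⟨K p, ⟨K p N, hdesc, ?_⟩, rfl⟩
    simp only [hfK]
    exact (stage_eq_resMarked_iff (hθ := hθ) hC hp N).1 hN
  · rintro p - i
    exact ⟨i + 1, fun p' _ hpp => congrArg idx (stage_congr θ hpp)⟩
  · rintro p G - hp z rfl t ⟨-, ht⟩ q rfl
    refine ⟨_, rfl, ?_⟩
    have := hfirst p G hp (q 0) ht
    rw [ht] at this
    simp only [hfK] at this
    rw [← (stage_eq_resMarked_iff (hθ := hθ) hC hp _).2 this.symm]
    exact name_wpName θ hθ _
  · rintro p q G - hp z rfl t ⟨-, ht⟩ rfl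
    have hn := hfirst p G hp (q 0) ht
    refine ⟨first p (q 0) + 1, fun p' q' _ hpp hqq => ?_⟩
    have hst : ∀ n ≤ first p (q 0), stage θ C p' n = stage θ C p n := fun n hn =>
      stage_congr θ (hpp.mono (by omega))
    have hq : q' 0 = q 0 := hqq 0 (by omega)
    have hmem : first p (q 0) ∈ {n | f (q 0) = residuallyRank hC (stage θ C p' n)} := by
      rw [Set.mem_ofPred_eq, hst _ le_rfl]
      exact hn
    have hle : first p' (q 0) ≤ first p (q 0) := Nat.sInf_le hmem
    have hge : first p (q 0) ≤ first p' (q 0) := by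
      refine Nat.sInf_le ?_
      have : f (q 0) = residuallyRank hC (stage θ C p' (first p' (q 0))) :=
        Nat.sInf_mem ⟨_, hmem⟩
      rwa [hst _ hle] at this
    change wpName θ (stage θ C p' (first p' (q' 0))).1 = wpName θ (stage θ C p (first p (q 0))).1
    rw [hq, le_antisymm hle hge, hst _ le_rfl]

end Upper

/-! ### Groups with prescribed commutators -/

section Transvection

variable {k : ℕ}

/-- The free group on `x_1, …, x_k` and letters `z_m`, `m ∈ ℤ`. -/
abbrev LetterGroup (k : ℕ) : Type := FreeGroup (Fin k ⊕ ℤ)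

/-- The inclusion of the free group on `x_1, …, x_k`. -/
def xIncl (k : ℕ) : FreeGroup (Fin k) →* LetterGroup k := FreeGroup.map Sum.inl

/-- The endomorphism fixing the `x_i` and sending `z_m` to `c m * z_m`. -/
def transvectionHom (c : ℤ → FreeGroup (Fin k)) : LetterGroup k →* LetterGroup k :=
  FreeGroup.lift (Sum.elim (fun i => FreeGroup.of (Sum.inl i))
    fun m => xIncl k (c m) * FreeGroup.of (Sum.inr m))

theorem transvectionHom_xIncl (c : ℤ → FreeGroup (Fin k)) (w : FreeGroup (Fin k)) :
    transvectionHom c (xIncl k w) = xIncl k w := by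
  have : (transvectionHom c).comp (xIncl k) = xIncl k := by
    ext i
    simp [transvectionHom, xIncl]
  exact DFunLike.congr_fun this w

theorem transvectionHom_z (c : ℤ → FreeGroup (Fin k)) (m : ℤ) :
    transvectionHom c (FreeGroup.of (Sum.inr m)) = xIncl k (c m) * FreeGroup.of (Sum.inr m) := by
  simp [transvectionHom]

theorem transvectionHom_comp_of_mul_eq_one {c d : ℤ → FreeGroup (Fin k)}
    (h : ∀ m, c m * d m = 1) :
    (transvectionHom d).comp (transvectionHom c) = MonoidHom.id (LetterGroup k) := by
  ext (i | m)
  · simp [transvectionHom]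
  · rw [MonoidHom.comp_apply, transvectionHom_z, map_mul, transvectionHom_xIncl,
      transvectionHom_z, ← mul_assoc, ← map_mul, h, map_one, one_mul, MonoidHom.id_apply]

/-- The automorphism fixing the `x_i` and sending `z_m` to `c m * z_m`. -/
def transvection (c : ℤ → FreeGroup (Fin k)) : MulAut (LetterGroup k) :=
  MonoidHom.toMulEquiv (transvectionHom c) (transvectionHom fun m => (c m)⁻¹)
    (transvectionHom_comp_of_mul_eq_one fun m => mul_inv_cancel (c m))
    (transvectionHom_comp_of_mul_eq_one fun m => inv_mul_cancel (c m))

/-- The automorphism fixing the `x_i` and sending `z_m` to `z_(m+1)`. -/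
def shift (k : ℕ) : MulAut (LetterGroup k) :=
  FreeGroup.freeGroupCongr (Equiv.sumCongr (Equiv.refl (Fin k)) (Equiv.addRight (1 : ℤ)))

/-- The action of the free group on `t` (the letter `true`) and `y` (the letter `false`) through
the shift and the transvection. -/
def letterAction (c : ℤ → FreeGroup (Fin k)) : FreeGroup Bool →* MulAut (LetterGroup k) :=
  FreeGroup.lift fun b => if b then shift k else transvection c

/-- The group in which the commutator of `y` and `t ^ j * z * t ^ (-j)` is the word `c j`. The
actors `t` and `y` generate a free group, so that the second component of a word in the generators
does not depend on `c`. -/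
abbrev CommutatorGroup (c : ℤ → FreeGroup (Fin k)) : Type :=
  LetterGroup k ⋊[letterAction c] FreeGroup Bool

/-- The marking of the group by `x_1, …, x_k`, `z = z_0`, `t` and `y`. -/
def commutatorMarking (c : ℤ → FreeGroup (Fin k)) :
    FreeGroup (Fin (k + 3)) →* CommutatorGroup c :=
  FreeGroup.lift (Fin.append (fun i => SemidirectProduct.inl (FreeGroup.of (Sum.inl i)))
    ![SemidirectProduct.inl (FreeGroup.of (Sum.inr 0)),
      SemidirectProduct.inr (FreeGroup.of true), SemidirectProduct.inr (FreeGroup.of false)])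

/-- Words in the first `k` of `k + 3` letters. -/
def firstLetters (k : ℕ) : FreeGroup (Fin k) →* FreeGroup (Fin (k + 3)) :=
  FreeGroup.map (Fin.castAdd 3)

/-- Words in the last three of `k + 3` letters. -/
def lastLetters (k : ℕ) : FreeGroup (Fin 3) →* FreeGroup (Fin (k + 3)) :=
  FreeGroup.map (Fin.natAdd k)

/-- The projection onto the free group on the first `k` letters, which kills the others. -/
def killLastLetters (k : ℕ) : FreeGroup (Fin (k + 3)) →* FreeGroup (Fin k) :=
  FreeGroup.lift (Fin.append FreeGroup.of fun _ => 1)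

/-- The word `y z' y⁻¹ z'⁻¹`, where `z' = t ^ j * z * t ^ (-j)`. -/
def commutatorWord (j : ℕ) : FreeGroup (Fin 3) :=
  FreeGroup.of 2 * (FreeGroup.of 1 ^ j * FreeGroup.of 0 * (FreeGroup.of 1 ^ j)⁻¹) *
    (FreeGroup.of 2)⁻¹ * (FreeGroup.of 1 ^ j * FreeGroup.of 0 * (FreeGroup.of 1 ^ j)⁻¹)⁻¹

theorem killLastLetters_firstLetters (w : FreeGroup (Fin k)) :
    killLastLetters k (firstLetters k w) = w := by
  have : (killLastLetters k).comp (firstLetters k) = MonoidHom.id _ := by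
    ext i
    simp [killLastLetters, firstLetters]
  exact DFunLike.congr_fun this w

theorem killLastLetters_surjective : Function.Surjective (killLastLetters k) :=
  fun w => ⟨_, killLastLetters_firstLetters w⟩

theorem commutatorMarking_firstLetters (c : ℤ → FreeGroup (Fin k)) (w : FreeGroup (Fin k)) :
    commutatorMarking c (firstLetters k w) = SemidirectProduct.inl (xIncl k w) := by
  have : (commutatorMarking c).comp (firstLetters k) =
      SemidirectProduct.inl.comp (xIncl k) := by
    ext i <;> simp [commutatorMarking, firstLetters, xIncl]
  exact DFunLike.congr_fun this w

theorem shift_pow_z (j : ℕ) :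
    (shift k ^ j) (FreeGroup.of (Sum.inr 0)) = FreeGroup.of (Sum.inr (j : ℤ)) := by
  induction j with
  | zero => simp
  | succ j ih =>
    rw [pow_succ', MulAut.mul_apply, ih]
    simp [shift]

/-- The defining property: `t ^ j` carries `z_0` to `z_j`, and `y z_j y⁻¹ = c_j z_j`. -/
theorem commutatorMarking_commutatorWord (c : ℤ → FreeGroup (Fin k)) (j : ℕ) :
    commutatorMarking c (lastLetters k (commutatorWord j)) =
      SemidirectProduct.inl (xIncl k (c j)) := by
  have h0 : commutatorMarking c (lastLetters k (FreeGroup.of 0)) =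
      SemidirectProduct.inl (FreeGroup.of (Sum.inr 0)) := by
    simp [commutatorMarking, lastLetters]
  have h1 : commutatorMarking c (lastLetters k (FreeGroup.of 1)) =
      SemidirectProduct.inr (FreeGroup.of true) := by
    simp [commutatorMarking, lastLetters]
  have h2 : commutatorMarking c (lastLetters k (FreeGroup.of 2)) =
      SemidirectProduct.inr (FreeGroup.of false) := by
    simp [commutatorMarking, lastLetters]
  have hz : (SemidirectProduct.inr (FreeGroup.of true) : CommutatorGroup c) ^ j *
      SemidirectProduct.inl (FreeGroup.of (Sum.inr 0)) *
      (SemidirectProduct.inr (FreeGroup.of true) ^ j)⁻¹ =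
      SemidirectProduct.inl (FreeGroup.of (Sum.inr (j : ℤ))) := by
    rw [← map_pow, ← map_inv, ← SemidirectProduct.inl_aut, map_pow, letterAction,
      FreeGroup.lift_apply_of, if_pos rfl, shift_pow_z]
  have hy : (SemidirectProduct.inr (FreeGroup.of false) : CommutatorGroup c) *
      SemidirectProduct.inl (FreeGroup.of (Sum.inr (j : ℤ))) *
      (SemidirectProduct.inr (FreeGroup.of false))⁻¹ =
      SemidirectProduct.inl (xIncl k (c j) * FreeGroup.of (Sum.inr (j : ℤ))) := by
    rw [← map_inv, ← SemidirectProduct.inl_aut, letterAction, FreeGroup.lift_apply_of,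
      if_neg Bool.false_ne_true, ← transvectionHom_z]
    rfl
  rw [commutatorWord]
  simp only [map_mul, map_inv, map_pow, h0, h1, h2]
  rw [hz, hy, ← map_inv, ← map_mul, mul_inv_cancel_right]

/-- The marked group determined by `c`. -/
def commutatorMarked (c : ℤ → FreeGroup (Fin k)) : KMarkedGroup (k + 3) :=
  ⟨(commutatorMarking c).ker, inferInstance⟩

/-- Over an equationally noetherian `C`, finitely many of the words `[y, t ^ j * z * t ^ (-j)]`
imply all of them. If `c` is trivial on the corresponding positions, then every residually-`C`
quotient of the marked group satisfies all relations `c j = 1`. -/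
theorem EquationallyNoetherian.exists_bound {C : Set GrpCat.{u}}
    (hC : EquationallyNoetherian C) : ∃ J : ℕ, ∀ (k : ℕ) (c : ℤ → FreeGroup (Fin k)),
      (∀ j : ℕ, j < J → c j = 1) → ∀ j : ℕ,
        firstLetters k (c j) ∈ radical C ((commutatorMarked c).rels : Set (FreeGroup _)) := by
  obtain ⟨S₀, hS₀, hfin, hS⟩ := hC.exists_finite (Set.range commutatorWord)
  choose! idx hidx using hS₀
  obtain ⟨J, hJ⟩ := (hfin.image idx).bddAbove
  refine ⟨J + 1, fun k c hc j => mem_radical.2 fun H hH f _ hf => ?_⟩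
  have hrel : ∀ j : ℕ, f (lastLetters k (commutatorWord j)) = f (firstLetters k (c j)) := by
    intro j
    rw [← mul_inv_eq_one, ← map_inv, ← map_mul]
    refine hf _ (MonoidHom.mem_ker.2 ?_)
    rw [map_mul, map_inv, commutatorMarking_commutatorWord, commutatorMarking_firstLetters,
      mul_inv_cancel]
  rw [← hrel]
  refine hS H hH (f.comp (lastLetters k)) ?_ _ ⟨j, rfl⟩
  intro s hs
  rw [← hidx hs, MonoidHom.comp_apply, hrel, hc _ (Nat.lt_succ_of_le (hJ ⟨s, hs, rfl⟩)), map_one,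
    map_one]

/-- If a marked group `E` satisfies all relations `c m = 1`, then killing `z`, `t` and `y` maps
the marked group determined by `c` onto `E`. -/
theorem commutatorMarked_rels_le {c : ℤ → FreeGroup (Fin k)} {E : KMarkedGroup k}
    (hc : ∀ m, c m ∈ E.rels) :
    (commutatorMarked c).rels ≤ E.rels.comap (killLastLetters k) := by
  let q : LetterGroup k →* E.Carrier :=
    FreeGroup.lift (Sum.elim (fun i => QuotientGroup.mk' E.rels (FreeGroup.of i)) fun _ => 1)
  have hqx : ∀ w, q (xIncl k w) = QuotientGroup.mk' E.rels w := by
    intro w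
    have : q.comp (xIncl k) = QuotientGroup.mk' E.rels := by
      ext i
      simp [q, xIncl]
    exact DFunLike.congr_fun this w
  have hinv : ∀ a n, q (letterAction c a n) = q n := by
    have hgen : ∀ b n, q (letterAction c (FreeGroup.of b) n) = q n := by
      intro b n
      have : q.comp (letterAction c (FreeGroup.of b)).toMonoidHom = q := by
        cases b
        · ext (i | m)
          · simp [letterAction, transvection, transvectionHom, q]
          · have hm : (QuotientGroup.mk' E.rels) (c m) = 1 :=
              (QuotientGroup.eq_one_iff _).2 (hc m)
            have h1 : (letterAction c (FreeGroup.of false)) (FreeGroup.of (Sum.inr m)) =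
                xIncl k (c m) * FreeGroup.of (Sum.inr m) := by
              rw [← transvectionHom_z, letterAction, FreeGroup.lift_apply_of]
              rfl
            change q ((letterAction c (FreeGroup.of false)) (FreeGroup.of (Sum.inr m))) = _
            rw [h1, map_mul, hqx, hm, one_mul]
        · ext (i | m)
          · simp [letterAction, shift, q]
          · simp [letterAction, shift, q]
      exact DFunLike.congr_fun this n
    intro a
    induction a using FreeGroup.induction_on with
    | C1 => simp
    | of b => exact hgen b
    | inv_of b ih =>
      intro n
      rw [← ih, map_inv, MulAut.apply_inv_self]
    | mul a b iha ihb =>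
      intro n
      rw [map_mul, MulAut.mul_apply, iha, ihb]
  let F : CommutatorGroup c →* E.Carrier := SemidirectProduct.lift q 1 fun a => by
    ext n
    simp [hinv]
  have hF : F.comp (commutatorMarking c) =
      (QuotientGroup.mk' E.rels).comp (killLastLetters k) := by
    ext i
    refine Fin.addCases (fun i => ?_) (fun i => ?_) i
    · simp [F, q, commutatorMarking, killLastLetters]
    · fin_cases i <;> simp [F, q, commutatorMarking, killLastLetters]
  intro w hw
  have h1 : commutatorMarking c w = 1 := hw
  refine (QuotientGroup.eq_one_iff (killLastLetters k w)).1 ?_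
  have := DFunLike.congr_fun hF w
  rw [MonoidHom.comp_apply, h1, map_one] at this
  exact this.symm

/-- A residually-`C` group satisfying all relations `c m = 1` is a quotient of the residual quotient
of the marked group determined by `c`. -/
theorem radical_commutatorMarked_le {C : Set GrpCat.{u}} {c : ℤ → FreeGroup (Fin k)}
    {E : KMarkedGroup k} (hE : IsResidually C E.Carrier) (hc : ∀ m, c m ∈ E.rels) :
    radical C ((commutatorMarked c).rels : Set (FreeGroup (Fin (k + 3)))) ≤
      E.rels.comap (killLastLetters k) := by
  intro w hw
  by_contra hwE
  obtain ⟨H, hH, f, hf, hfE, hfw⟩ := isResidually_iff.1 hE _ hwE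
  exact hfw (mem_radical.1 hw H hH (f.comp (killLastLetters k))
    (hf.comp killLastLetters_surjective) fun s hs => hfE _ (commutatorMarked_rels_le hc hs))

/-! ### Dependence on finitely many parameters -/

/-- `f c` is determined by finitely many values of `c`, near each `c`. This is continuity for the
product topology and discrete values. -/
def FinitelyDetermined {A B : Type} (f : (ℤ → A) → B) : Prop :=
  ∀ c, ∃ S : Finset ℤ, ∀ c', (∀ m ∈ S, c' m = c m) → f c' = f c

theorem FinitelyDetermined.const {A B : Type} (b : B) :
    FinitelyDetermined fun _ : ℤ → A => b := fun _ => ⟨∅, fun _ _ => rfl⟩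

theorem FinitelyDetermined.comp₂ {A B B' : Type} {F : (ℤ → A) → B → B'}
    {g : (ℤ → A) → B} (hF : ∀ b, FinitelyDetermined fun c => F c b)
    (hg : FinitelyDetermined g) : FinitelyDetermined fun c => F c (g c) := by
  classical
  intro c
  obtain ⟨S, hS⟩ := hg c
  obtain ⟨T, hT⟩ := hF (g c) c
  refine ⟨S ∪ T, fun c' h => ?_⟩
  beta_reduce
  rw [hS c' fun m hm => h m (Finset.mem_union_left _ hm)]
  exact hT c' fun m hm => h m (Finset.mem_union_right _ hm)

theorem FinitelyDetermined.mul {A B : Type} [Mul B] {f g : (ℤ → A) → B}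
    (hf : FinitelyDetermined f) (hg : FinitelyDetermined g) :
    FinitelyDetermined fun c => f c * g c :=
  FinitelyDetermined.comp₂ (F := fun c b => f c * b)
    (fun b => FinitelyDetermined.comp₂ (F := fun _ a => a * b)
      (fun a => FinitelyDetermined.const (a * b)) hf) hg

theorem FinitelyDetermined.inv {A B : Type} [Inv B] {f : (ℤ → A) → B}
    (hf : FinitelyDetermined f) : FinitelyDetermined fun c => (f c)⁻¹ :=
  FinitelyDetermined.comp₂ (F := fun _ a => a⁻¹)
    (fun a => FinitelyDetermined.const a⁻¹) hf

theorem finitelyDetermined_hom {A ι B : Type} [Group B] (f : (ℤ → A) → FreeGroup ι →* B)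
    (h : ∀ i, FinitelyDetermined fun c => f c (FreeGroup.of i)) (n : FreeGroup ι) :
    FinitelyDetermined fun c => f c n := by
  induction n using FreeGroup.induction_on with
  | C1 => simpa using FinitelyDetermined.const (1 : B)
  | of i => exact h i
  | inv_of i ih => simpa only [map_inv] using ih.inv
  | mul a b iha ihb => simpa only [map_mul] using iha.mul ihb

theorem finitelyDetermined_transvectionHom (e : FreeGroup (Fin k) → FreeGroup (Fin k))
    (n : LetterGroup k) :
    FinitelyDetermined fun c : ℤ → FreeGroup (Fin k) => transvectionHom (fun m => e (c m)) n := by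
  refine finitelyDetermined_hom _ (fun i => ?_) n
  rcases i with i | m
  · simpa [transvectionHom] using FinitelyDetermined.const _
  · intro c
    refine ⟨{m}, fun c' h => ?_⟩
    beta_reduce
    rw [transvectionHom_z, transvectionHom_z, h m (Finset.mem_singleton_self m)]

theorem finitelyDetermined_letterAction (a : FreeGroup Bool) : ∀ n : LetterGroup k,
    FinitelyDetermined fun c : ℤ → FreeGroup (Fin k) => letterAction c a n := by
  induction a using FreeGroup.induction_on with
  | C1 => intro n; simpa using FinitelyDetermined.const n
  | of b =>
    intro n
    cases b
    · have h : ∀ c : ℤ → FreeGroup (Fin k), letterAction c (FreeGroup.of false) n =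
          transvectionHom c n := fun c => by
        rw [letterAction, FreeGroup.lift_apply_of]
        rfl
      simp only [h]
      exact finitelyDetermined_transvectionHom id n
    · simpa [letterAction] using FinitelyDetermined.const (shift k n)
  | inv_of b =>
    intro n
    cases b
    · have h : ∀ c : ℤ → FreeGroup (Fin k), letterAction c (FreeGroup.of false)⁻¹ n =
          transvectionHom (fun m => (c m)⁻¹) n := fun c => by
        rw [map_inv, letterAction, FreeGroup.lift_apply_of]
        rfl
      simp only [h]
      exact finitelyDetermined_transvectionHom (fun w => w⁻¹) n
    · simpa [letterAction] using FinitelyDetermined.const ((shift k)⁻¹ n)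
  | mul a b iha ihb =>
    intro n
    simp only [map_mul, MulAut.mul_apply]
    exact FinitelyDetermined.comp₂ (F := fun c b => letterAction c a b)
      iha (ihb n)

/-- The component in the free group on `t` and `y` does not depend on `c`, so only the component in
`LetterGroup k` has to be controlled. -/
theorem commutatorMarking_right (c c' : ℤ → FreeGroup (Fin k)) (w : FreeGroup (Fin (k + 3))) :
    (commutatorMarking c w).right = (commutatorMarking c' w).right := by
  have : SemidirectProduct.rightHom.comp (commutatorMarking c) =
      SemidirectProduct.rightHom.comp (commutatorMarking c') := by
    ext i
    refine Fin.addCases (fun i => ?_) (fun i => ?_) i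
    · simp [commutatorMarking]
    · fin_cases i <;> simp [commutatorMarking]
  exact DFunLike.congr_fun this w

theorem finitelyDetermined_commutatorMarking_left (w : FreeGroup (Fin (k + 3))) :
    FinitelyDetermined fun c : ℤ → FreeGroup (Fin k) => (commutatorMarking c w).left := by
  have hof : ∀ i, ∃ n, ∀ c : ℤ → FreeGroup (Fin k),
      (commutatorMarking c (FreeGroup.of i)).left = n := by
    intro i
    refine Fin.addCases (fun i => ?_) (fun i => ?_) i
    · exact ⟨FreeGroup.of (Sum.inl i), fun c => by simp [commutatorMarking]⟩
    · fin_cases i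
      · exact ⟨FreeGroup.of (Sum.inr 0), fun c => by simp [commutatorMarking]⟩
      · exact ⟨1, fun c => by simp [commutatorMarking]⟩
      · exact ⟨1, fun c => by simp [commutatorMarking]⟩
  induction w using FreeGroup.induction_on with
  | C1 => simpa using FinitelyDetermined.const (1 : LetterGroup k)
  | of i =>
    obtain ⟨n, hn⟩ := hof i
    simpa only [hn] using FinitelyDetermined.const n
  | inv_of i =>
    obtain ⟨n, hn⟩ := hof i
    have h : ∀ c : ℤ → FreeGroup (Fin k), (commutatorMarking c (FreeGroup.of i)⁻¹).left =
        letterAction c (commutatorMarking 1 (FreeGroup.of i)).right⁻¹ n⁻¹ := fun c => by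
      rw [map_inv (commutatorMarking c), SemidirectProduct.inv_left, hn,
        commutatorMarking_right c 1]
    simp only [h]
    exact finitelyDetermined_letterAction _ _
  | mul a b iha ihb =>
    simp only [map_mul, SemidirectProduct.mul_left, fun c => commutatorMarking_right c 1 a]
    exact iha.mul (FinitelyDetermined.comp₂ (B' := LetterGroup k)
      (F := fun c n => letterAction c _ n) (finitelyDetermined_letterAction _) ihb)

theorem finitelyDetermined_mem_rels (w : FreeGroup (Fin (k + 3))) :
    FinitelyDetermined fun c : ℤ → FreeGroup (Fin k) => w ∈ (commutatorMarked c).rels := by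
  intro c
  obtain ⟨S, hS⟩ := finitelyDetermined_commutatorMarking_left w c
  have hmem : ∀ c : ℤ → FreeGroup (Fin k), w ∈ (commutatorMarked c).rels ↔
      (commutatorMarking c w).left = 1 ∧ (commutatorMarking c w).right = 1 := fun c =>
    MonoidHom.mem_ker.trans SemidirectProduct.ext_iff
  refine ⟨S, fun c' h => propext ?_⟩
  have h1 : (commutatorMarking c' w).left = (commutatorMarking c w).left := hS c' h
  beta_reduce
  rw [hmem, hmem, h1, commutatorMarking_right c' c]

end Transvection

/-! ### Marked groups of large rank -/

section LargeRank

variable {C : Set GrpCat.{u}} {k l : ℕ}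

/-- The marking of the group `G` by the images of `l` words in its generators. -/
def KMarkedGroup.pullback (G : KMarkedGroup k) (φ : FreeGroup (Fin l) →* FreeGroup (Fin k)) :
    KMarkedGroup l :=
  ⟨G.rels.comap φ, G.normal.comap φ⟩

theorem IsResidually.pullback {G : KMarkedGroup k} (hG : IsResidually C G.Carrier)
    {φ : FreeGroup (Fin l) →* FreeGroup (Fin k)} (hφ : Function.Surjective φ) :
    IsResidually C (G.pullback φ).Carrier := by
  rw [isResidually_iff] at hG ⊢
  intro w hw
  obtain ⟨H, hH, f, hf, hfG, hfw⟩ := hG (φ w) hw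
  exact ⟨H, hH, f.comp φ, hf.comp hφ, fun s hs => hfG _ hs, hfw⟩

/-- The smallest marked group with both `G` and `H` as marked quotients. -/
def KMarkedGroup.join (G H : KMarkedGroup k) : KMarkedGroup k :=
  ⟨G.rels ⊓ H.rels, inferInstance⟩

theorem IsResidually.join {G H : KMarkedGroup k} (hG : IsResidually C G.Carrier)
    (hH : IsResidually C H.Carrier) : IsResidually C (G.join H).Carrier := by
  rw [isResidually_iff] at hG hH ⊢
  intro w hw
  by_cases hwG : w ∈ G.rels
  · obtain ⟨K, hK, f, hf, hfH, hfw⟩ := hH w fun h => hw ⟨hwG, h⟩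
    exact ⟨K, hK, f, hf, fun s hs => hfH s hs.2, hfw⟩
  · obtain ⟨K, hK, f, hf, hfG, hfw⟩ := hG w hwG
    exact ⟨K, hK, f, hf, fun s hs => hfG s hs.1, hfw⟩

/-- The retraction of the free group of rank `k + 1` sending the last letter to `g`. -/
def evalLast (g : FreeGroup (Fin k)) : FreeGroup (Fin (k + 1)) →* FreeGroup (Fin k) :=
  FreeGroup.lift (Fin.append FreeGroup.of fun _ : Fin 1 => g)

theorem evalLast_surjective (g : FreeGroup (Fin k)) : Function.Surjective (evalLast g) := by
  intro w
  refine ⟨FreeGroup.map (Fin.castAdd 1) w, ?_⟩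
  have : (evalLast g).comp (FreeGroup.map (Fin.castAdd 1)) = MonoidHom.id _ := by
    ext i
    simp [evalLast]
  exact DFunLike.congr_fun this w

theorem evalLast_last (g : FreeGroup (Fin k)) :
    evalLast g (FreeGroup.of (Fin.natAdd k 0)) = g := by
  simp [evalLast]

/-- The same group with one more generator, which is trivial. -/
def addTrivialGenerator (G : residuallyMarked C) : residuallyMarked C :=
  ⟨⟨G.1.1 + 1, G.1.2.pullback (evalLast 1)⟩, IsResidually.pullback G.2 (evalLast_surjective 1)⟩

theorem addTrivialGenerator_strictMono :
    StrictMono (addTrivialGenerator : residuallyMarked C → residuallyMarked C) := by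
  rintro ⟨⟨l, H⟩, hH⟩ ⟨⟨k, G⟩, hG⟩ h
  obtain ⟨h1, h2⟩ := Sigma.lt_def.1 (show (⟨l, H⟩ : MarkedGroup) < ⟨k, G⟩ from h)
  dsimp only at h1
  subst h1
  refine Sigma.mk_lt_mk_iff.2 (lt_iff_le_not_ge.2 ⟨?_, fun h => h2.not_ge ?_⟩)
  · exact Subgroup.comap_mono h2.le
  · exact (Subgroup.comap_le_comap_of_surjective (evalLast_surjective 1)).1 h

theorem residuallyRank_le_of_strictMono (hC : EquationallyNoetherian C)
    {e : residuallyMarked C → residuallyMarked C} (he : StrictMono e) (G : residuallyMarked C) :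
    residuallyRank hC G ≤ residuallyRank hC (e G) := by
  have := hC.wellFoundedLT
  induction G using WellFoundedLT.induction with
  | ind G ih =>
    refine le_of_forall_lt fun β hβ => ?_
    obtain ⟨H, hH, hβH⟩ := (lt_residuallyRank hC).1 hβ
    exact (hβH.trans (ih H hH)).trans_lt (residuallyRank_strictMono hC (he hH))

/-- The ordinal `residualRank` is a limit unless it is `1`: to a non-trivial group `G` one adds
a generator and passes to the subgroup of `G × G` generated by the pairs `(x_i, x_i)` and `(1, g)`,
which has `G` with a trivial generator added as a proper quotient. -/
theorem exists_lt_residuallyRank (hC : EquationallyNoetherian C) {β : Ordinal.{0}}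
    (h0 : β ≠ 0) (hβ : β < residualRank C hC) :
    ∃ G : residuallyMarked C, β < residuallyRank hC G := by
  obtain ⟨G, hG⟩ := (lt_residualRank hC).1 hβ
  obtain ⟨H, hHG, -⟩ := (lt_residuallyRank hC).1 ((pos_iff_ne_zero.2 h0).trans_le hG)
  obtain ⟨g, hg⟩ : ∃ g, g ∉ G.1.2.rels := by
    by_contra! hall
    obtain ⟨⟨l, H⟩, hH⟩ := H
    obtain ⟨⟨k, G⟩, hG'⟩ := G
    obtain ⟨h1, h2⟩ := Sigma.lt_def.1 (show (⟨l, H⟩ : MarkedGroup) < ⟨k, G⟩ from hHG)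
    dsimp only at h1
    subst h1
    exact h2.not_ge fun w _ => hall w
  let G' : residuallyMarked C :=
    ⟨⟨G.1.1 + 1, (G.1.2.pullback (evalLast 1)).join (G.1.2.pullback (evalLast g))⟩,
      (IsResidually.pullback G.2 (evalLast_surjective 1)).join
        (IsResidually.pullback G.2 (evalLast_surjective g))⟩
  refine ⟨G', (hG.trans
    (residuallyRank_le_of_strictMono hC addTrivialGenerator_strictMono G)).trans_lt
    (residuallyRank_strictMono hC ?_)⟩
  refine Sigma.mk_lt_mk_iff.2 (lt_iff_le_not_ge.2 ⟨fun w hw => hw.1, fun h => hg ?_⟩)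
  have hmem : FreeGroup.of (Fin.natAdd G.1.1 0) ∈ (G.1.2.pullback (evalLast 1)).rels := by
    change evalLast 1 _ ∈ G.1.2.rels
    rw [evalLast_last]
    exact one_mem _
  have : evalLast g (FreeGroup.of (Fin.natAdd G.1.1 0)) ∈ G.1.2.rels := (h hmem).2
  rwa [evalLast_last] at this

end LargeRank

/-! ### Following a descending sequence of ordinals -/

section Descent

variable {C : Set GrpCat.{u}} {k : ℕ}

/-- The residually-`C` marked groups with `k` generators. -/
abbrev ResiduallyKMarked (C : Set GrpCat.{u}) (k : ℕ) : Type :=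
  {G : KMarkedGroup k // IsResidually C G.Carrier}

/-- The rank of a `k`-marked residually-`C` group in the order on all of them. -/
noncomputable def ResiduallyKMarked.rank (hC : EquationallyNoetherian C)
    (G : ResiduallyKMarked C k) : Ordinal.{0} :=
  residuallyRank hC ⟨⟨k, G.1⟩, G.2⟩

theorem ResiduallyKMarked.exists_quotient (hC : EquationallyNoetherian C)
    (G : ResiduallyKMarked C k) (β : Ordinal.{0}) :
    ∃ x : ResiduallyKMarked C k × FreeGroup (Fin k), β < G.rank hC →
      x.2 ∉ G.1.rels ∧ x.2 ∈ x.1.1.rels ∧ G.1.rels ≤ x.1.1.rels ∧ β ≤ x.1.rank hC := by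
  by_cases hβ : β < G.rank hC
  · obtain ⟨⟨⟨l, H⟩, hH⟩, hHG, hβH⟩ := (lt_residuallyRank hC).1 hβ
    obtain ⟨h1, h2⟩ := Sigma.lt_def.1 (show (⟨l, H⟩ : MarkedGroup) < ⟨k, G.1⟩ from hHG)
    dsimp only at h1
    subst h1
    obtain ⟨d, hdH, hdG⟩ := SetLike.not_le_iff_exists.1 (show ¬ H.rels ≤ G.1.rels from h2.not_ge)
    exact ⟨(⟨H, hH⟩, d), fun _ => ⟨hdG, hdH, h2.le, hβH⟩⟩
  · exact ⟨(G, 1), fun h => absurd h hβ⟩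

/-- For `β < rank G`, a quotient of `G` that has rank at least `β` and satisfies one more
relation. -/
noncomputable def ResiduallyKMarked.next (hC : EquationallyNoetherian C)
    (G : ResiduallyKMarked C k) (β : Ordinal.{0}) : ResiduallyKMarked C k :=
  (G.exists_quotient hC β).choose.1

/-- A relation of `G.next hC β` that does not hold in `G`. It is chosen before the ordinal below
`β` to be encoded next is known. -/
noncomputable def ResiduallyKMarked.witness (hC : EquationallyNoetherian C)
    (G : ResiduallyKMarked C k) (β : Ordinal.{0}) : FreeGroup (Fin k) :=
  (G.exists_quotient hC β).choose.2

theorem ResiduallyKMarked.next_spec (hC : EquationallyNoetherian C)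
    {G : ResiduallyKMarked C k} {β : Ordinal.{0}} (h : β < G.rank hC) :
    G.witness hC β ∉ G.1.rels ∧ G.witness hC β ∈ (G.next hC β).1.rels ∧
      G.1.rels ≤ (G.next hC β).1.rels ∧ β ≤ (G.next hC β).rank hC :=
  (G.exists_quotient hC β).choose_spec h

open Classical in
/-- The group reached after reading `b 0, …, b n`: each strict descent of `b` imposes one more
relation. -/
noncomputable def descentState (hC : EquationallyNoetherian C) (G : ResiduallyKMarked C k)
    (b : ℕ → Ordinal.{0}) : ℕ → ResiduallyKMarked C k
  | 0 => G
  | n + 1 => if b (n + 1) < b n then (descentState hC G b n).next hC (b n)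
      else descentState hC G b n

open Classical in
/-- The relation imposed by the step from `b n` to `b (n + 1)`; it is trivial if `b` does not
descend there. -/
noncomputable def descentWord (hC : EquationallyNoetherian C) (G : ResiduallyKMarked C k)
    (b : ℕ → Ordinal.{0}) (n : ℕ) : FreeGroup (Fin k) :=
  if b (n + 1) < b n then (descentState hC G b n).witness hC (b n) else 1

/-- The words `descentWord`, placed from position `J` on. -/
noncomputable def descentCoeff (hC : EquationallyNoetherian C) (J : ℕ)
    (G : ResiduallyKMarked C k) (b : ℕ → Ordinal.{0}) (m : ℤ) : FreeGroup (Fin k) :=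
  if m < J then 1 else descentWord hC G b (m - J).toNat

variable (hC : EquationallyNoetherian C) {G : ResiduallyKMarked C k} {b b' : ℕ → Ordinal.{0}}

theorem descentState_congr {n : ℕ} (h : ∀ j ≤ n, b' j = b j) :
    descentState hC G b' n = descentState hC G b n := by
  induction n with
  | zero => rfl
  | succ n ih =>
    rw [descentState, descentState, ih fun j hj => h j (hj.trans n.le_succ),
      h n n.le_succ, h (n + 1) le_rfl]

theorem descentWord_congr {n : ℕ} (h : ∀ j ≤ n + 1, b' j = b j) :
    descentWord hC G b' n = descentWord hC G b n := by
  rw [descentWord, descentWord, descentState_congr hC fun j hj => h j (hj.trans n.le_succ),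
    h n n.le_succ, h (n + 1) le_rfl]

theorem descentState_succ_of_lt {n : ℕ} (h : b (n + 1) < b n) :
    descentState hC G b (n + 1) = (descentState hC G b n).next hC (b n) := by
  rw [descentState, if_pos h]

theorem descentState_succ_of_eq {n : ℕ} (h : b (n + 1) = b n) :
    descentState hC G b (n + 1) = descentState hC G b n := by
  rw [descentState, if_neg h.not_lt]

/-- The invariant of the descent: unless the ordinal `0` has been reached, the current group has
larger rank than the current ordinal, so a witness is available. -/
theorem lt_rank_descentState (hb : Antitone b) (h0 : b 0 ≠ 0 → b 0 < G.rank hC) (n : ℕ)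
    (hn : b n ≠ 0) : b n < (descentState hC G b n).rank hC := by
  induction n with
  | zero => exact h0 hn
  | succ n ih =>
    rcases (hb n.le_succ).lt_or_eq with h | h
    · have := ih (ne_bot_of_gt h)
      rw [descentState_succ_of_lt hC h]
      exact h.trans_le (ResiduallyKMarked.next_spec hC this).2.2.2
    · rw [descentState_succ_of_eq hC h]
      rw [h] at hn ⊢
      exact ih hn

theorem descentState_rels_mono (hb : Antitone b) (h0 : b 0 ≠ 0 → b 0 < G.rank hC) :
    Monotone fun n => (descentState hC G b n).1.rels := by
  refine monotone_nat_of_le_succ fun n => ?_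
  rcases (hb n.le_succ).lt_or_eq with h | h
  · rw [descentState_succ_of_lt hC h]
    exact (ResiduallyKMarked.next_spec hC
      (lt_rank_descentState hC hb h0 n (ne_bot_of_gt h))).2.2.1
  · rw [descentState_succ_of_eq hC h]

theorem descentWord_mem (hb : Antitone b) (h0 : b 0 ≠ 0 → b 0 < G.rank hC) (n : ℕ) :
    descentWord hC G b n ∈ (descentState hC G b (n + 1)).1.rels := by
  rcases (hb n.le_succ).lt_or_eq with h | h
  · rw [descentState_succ_of_lt hC h, descentWord, if_pos h]
    exact (ResiduallyKMarked.next_spec hC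
      (lt_rank_descentState hC hb h0 n (ne_bot_of_gt h))).2.1
  · rw [descentWord, if_neg h.not_lt]
    exact one_mem _

theorem descentCoeff_mem (hb : Antitone b) (h0 : b 0 ≠ 0 → b 0 < G.rank hC) {N : ℕ}
    (hN : ∀ m ≥ N, b m = b N) (J : ℕ) (m : ℤ) :
    descentCoeff hC J G b m ∈ (descentState hC G b N).1.rels := by
  rw [descentCoeff]
  split_ifs with h
  · exact one_mem _
  · rcases lt_or_ge (m - J).toNat N with h' | h'
    · exact descentState_rels_mono hC hb h0 h' (descentWord_mem hC hb h0 _)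
    · have heq : b ((m - J).toNat + 1) = b (m - J).toNat := by
        rw [hN _ h', hN _ (h'.trans (Nat.le_succ _))]
      rw [descentWord, if_neg heq.not_lt]
      exact one_mem _

theorem descentState_eq_of_constant {n m : ℕ} (hnm : n ≤ m)
    (h : ∀ j, n ≤ j → j ≤ m → b j = b n) :
    descentState hC G b m = descentState hC G b n := by
  induction m, hnm using Nat.le_induction with
  | base => rfl
  | succ m hm ih =>
    rw [descentState_succ_of_eq hC, ih fun j h1 h2 => h j h1 (h2.trans m.le_succ)]
    rw [h m hm m.le_succ, h (m + 1) (hm.trans m.le_succ) le_rfl]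

/-- If `b` is not constant from `n` on, then the next relation to be imposed is the witness
that is known at time `n`. -/
theorem exists_descentWord_eq_witness (hb : Antitone b) {n : ℕ} (h : ∃ m ≥ n, b m ≠ b n) :
    ∃ m, descentWord hC G b m = (descentState hC G b n).witness hC (b n) := by
  classical
  obtain ⟨hle, hne⟩ := Nat.find_spec h
  have hmin : ∀ j, n ≤ j → j < Nat.find h → b j = b n := fun j hj hjm => by
    by_contra hj'
    exact Nat.find_min h hjm ⟨hj, hj'⟩
  obtain ⟨m, hm⟩ : ∃ m, Nat.find h = m + 1 := by
    refine Nat.exists_eq_succ_of_ne_zero fun h0 => hne ?_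
    rw [h0] at hle ⊢
    rw [Nat.le_zero.1 hle]
  rw [hm] at hle hne hmin
  have hnm : n ≤ m := by
    by_contra hlt
    exact hne (by rw [le_antisymm hle (by omega)])
  have hbm : b m = b n := hmin m hnm m.lt_succ_self
  refine ⟨m, ?_⟩
  have hlt : b (m + 1) < b m := (hb m.le_succ).lt_of_ne (by rwa [hbm])
  rw [descentWord, if_pos hlt, hbm,
    descentState_eq_of_constant hC hnm fun j h1 h2 => hmin j h1 (Nat.lt_succ_of_le h2)]

end Descent

/-! ### Reducing limits of descending ordinals to the residual quotient -/

section Lower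

variable {C : Set GrpCat.{u}} (hC : EquationallyNoetherian C)

/-- The marked group that encodes the sequence `b`. -/
noncomputable def descentMarked {k : ℕ} (J : ℕ) (G : ResiduallyKMarked C k)
    (b : ℕ → Ordinal.{0}) : KMarkedGroup (k + 3) :=
  commutatorMarked (descentCoeff hC J G b)

/-- The test word that is available at time `n`: it dies in the residual quotient of the group
encoding `b` as soon as `b` descends after time `n`. -/
noncomputable def testWord {k : ℕ} (G : ResiduallyKMarked C k) (b : ℕ → Ordinal.{0}) (n : ℕ) :
    FreeGroup (Fin (k + 3)) :=
  firstLetters k ((descentState hC G b n).witness hC (b n))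

variable {k : ℕ} {G : ResiduallyKMarked C k} {b : ℕ → Ordinal.{0}}

theorem testWord_congr {b' : ℕ → Ordinal.{0}} {n : ℕ} (h : ∀ j ≤ n, b' j = b j) :
    testWord hC G b' n = testWord hC G b n := by
  rw [testWord, testWord, descentState_congr hC h, h n le_rfl]

/-- Continuity of the encoding: whether a word is a relation depends on finitely many terms
of `b`. -/
theorem exists_agree_descentMarked (J : ℕ) (w : FreeGroup (Fin (k + 3))) : ∃ m : ℕ,
    ∀ b' : ℕ → Ordinal.{0}, (∀ j < m, b' j = b j) →
      (w ∈ (descentMarked hC J G b').rels ↔ w ∈ (descentMarked hC J G b).rels) := by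
  obtain ⟨S, hS⟩ := finitelyDetermined_mem_rels w (descentCoeff hC J G b)
  refine ⟨S.sup (fun m => (m - J).toNat) + 2, fun b' h => Iff.of_eq (hS _ fun m hm => ?_)⟩
  have hle : (m - J).toNat ≤ S.sup fun m => (m - J).toNat :=
    Finset.le_sup (f := fun m : ℤ => (m - J).toNat) hm
  rw [descentCoeff, descentCoeff, descentWord_congr hC fun j hj => h j (by omega)]

/-- Once `b` has become constant, the current test word survives: all relations imposed on the
free group hold in the current state, where the test word is non-trivial. -/
theorem testWord_notMem_radical (hb : Antitone b) (h0 : b 0 ≠ 0 → b 0 < G.rank hC) {N : ℕ}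
    (hN : ∀ m ≥ N, b m = b N) (J : ℕ) : b N = 0 ∨ testWord hC G b N ∉
      radical C ((descentMarked hC J G b).rels : Set (FreeGroup (Fin (k + 3)))) := by
  refine or_iff_not_imp_left.2 fun hbN hmem => ?_
  have h := radical_commutatorMarked_le (descentState hC G b N).2
    (descentCoeff_mem hC hb h0 hN J) hmem
  rw [Subgroup.mem_comap, testWord, killLastLetters_firstLetters] at h
  exact (ResiduallyKMarked.next_spec hC (lt_rank_descentState hC hb h0 N hbN)).1 h

/-- A test word that survives certifies that its time is past the last descent of `b`. -/
theorem eq_of_testWord_notMem_radical (hb : Antitone b) {J : ℕ}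
    (hJ : ∀ (k : ℕ) (c : ℤ → FreeGroup (Fin k)), (∀ j : ℕ, j < J → c j = 1) → ∀ j : ℕ,
      firstLetters k (c j) ∈
        radical C ((commutatorMarked c).rels : Set (FreeGroup (Fin (k + 3))))) {n : ℕ}
    (hn : b n = 0 ∨ testWord hC G b n ∉
      radical C ((descentMarked hC J G b).rels : Set (FreeGroup (Fin (k + 3))))) :
    ∀ m ≥ n, b m = b n := by
  by_contra! hne
  rcases hn with hn | hn
  · obtain ⟨m, hm, hne⟩ := hne
    exact hne (le_antisymm (hb hm) (by rw [hn]; exact bot_le))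
  · obtain ⟨m, hm⟩ := exists_descentWord_eq_witness hC (G := G) hb hne
    refine hn ?_
    have hcoeff : descentCoeff hC J G b ((J + m : ℕ) : ℤ) = descentWord hC G b m := by
      rw [descentCoeff, if_neg (by push_cast; omega)]
      congr 1
      push_cast
      omega
    rw [testWord, ← hm, ← hcoeff]
    refine hJ k _ (fun j hj => ?_) (J + m)
    rw [descentCoeff, if_pos (by exact_mod_cast hj)]

/-- The sequence `u` is encoded as the marked group `descentMarked` of the ordinals `g (u n)`; the
answer is read off at the first time whose test word survives in the residual quotient, or at
which the ordinal `0` has been reached. -/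
theorem limDescending_le_resProblem {θ : ∀ k : ℕ, ℕ → FreeGroup (Fin k)}
    {hθ : ∀ k, Function.Surjective (θ k)} {g : ℕ → Ordinal.{0}}
    (hg : ∀ n, g n < residualRank C hC) :
    WeihrauchLE (limDescending g) (resProblem θ hθ C) := by
  classical
  obtain ⟨J, hJ⟩ := hC.exists_bound
  have hstart : ∀ β, ∃ G : residuallyMarked C, β < residualRank C hC → β ≠ 0 →
      β < residuallyRank hC G := fun β => by
    by_cases h : β ≠ 0 ∧ β < residualRank C hC
    · obtain ⟨G, hG⟩ := exists_lt_residuallyRank hC h.1 h.2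
      exact ⟨G, fun _ _ => hG⟩
    · exact ⟨radicalPoint C 0 ∅, fun h1 h2 => absurd ⟨h2, h1⟩ h⟩
  choose start hstart using hstart
  choose idx hidx using fun k => hθ k
  let S : (β : Ordinal.{0}) → ResiduallyKMarked C (start β).1.1 := fun β =>
    ⟨(start β).1.2, (start β).2⟩
  let M : Ordinal.{0} → (ℕ → Ordinal.{0}) → MarkedGroup := fun β b =>
    ⟨(start β).1.1 + 3, descentMarked hC J (S β) b⟩
  -- The position at which a name of the residual quotient decides the test word of time `n`.
  let code : Ordinal.{0} → (ℕ → Ordinal.{0}) → ℕ → ℕ := fun β b n =>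
    idx ((start β).1.1 + 3) (testWord hC (S β) b n)
  let K : (ℕ → ℕ) → (ℕ → ℕ) := fun u => wpName θ (M (g (u 0)) fun n => g (u n))
  let good : (ℕ → ℕ) → (ℕ → ℕ) → Set ℕ := fun u q =>
    {n | g (u n) = 0 ∨ q (code (g (u 0)) (fun n => g (u n)) n + 1) = 0}
  let D : (ℕ → ℕ) → (ℕ → ℕ) → (ℕ → ℕ) := fun u q _ => u (sInf (good u q))
  have hanti : ∀ u ∈ (limDescending g).toFun.dom, Antitone fun n => g (u n) := by
    rintro u ⟨t, hu, -⟩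
    exact antitone_nat_of_succ_le hu
  have hrank : ∀ u : ℕ → ℕ, g (u 0) ≠ 0 → g (u 0) < (S (g (u 0))).rank hC := fun u h =>
    hstart _ (hg _) h
  have hgood_iff : ∀ u q, (wpRep θ hθ).name q (resMarked C (M (g (u 0)) fun n => g (u n))) →
      ∀ n, n ∈ good u q ↔ g (u n) = 0 ∨ testWord hC (S (g (u 0))) (fun n => g (u n)) n ∉
        radical C ((descentMarked hC J (S (g (u 0))) fun n => g (u n)).rels :
          Set (FreeGroup (Fin ((start (g (u 0))).1.1 + 3)))) := by
    intro u q hq n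
    refine or_congr Iff.rfl ?_
    have h := wpRep_digit_eq_zero hq (code (g (u 0)) (fun n => g (u n)) n)
    rw [resMarked_eq] at h
    refine h.trans (not_congr ?_)
    change θ _ (idx _ _) ∈ _ ↔ _
    rw [hidx]
    rfl
  have hne : ∀ u ∈ (limDescending g).toFun.dom, ∀ q,
      (wpRep θ hθ).name q (resMarked C (M (g (u 0)) fun n => g (u n))) →
        (good u q).Nonempty := by
    intro u hu q hq
    obtain ⟨N, hN⟩ := ciInf_mem fun n => g (u n)
    refine ⟨N, (hgood_iff u q hq N).2
      (testWord_notMem_radical hC (hanti u hu) (hrank u) (fun m hm => ?_) J)⟩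
    refine le_antisymm (hanti u hu hm) ?_
    exact hN.le.trans (ciInf_le' _ m)
  refine weihrauchLE_of_realizers K D ?_ ?_ ?_ ?_
  · rintro u _ - rfl
    exact ⟨M (g (u 0)) fun n => g (u n), ⟨_, rfl⟩, name_wpName θ hθ _⟩
  · rintro u - i
    rcases i with _ | i
    · refine ⟨1, fun u' _ h => ?_⟩
      have h0 : u' 0 = u 0 := h 0 one_pos
      change (start (g (u' 0))).1.1 + 3 = (start (g (u 0))).1.1 + 3
      rw [h0]
    · obtain ⟨m, hm⟩ := exists_agree_descentMarked hC (G := S (g (u 0)))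
        (b := fun n => g (u n)) J (θ ((start (g (u 0))).1.1 + 3) i)
      refine ⟨m + 1, fun u' _ h => ?_⟩
      have h0 : u' 0 = u 0 := h 0 m.succ_pos
      have hmem := hm (fun n => g (u' n)) fun j hj => by rw [h j (by omega)]
      change wpName θ (M (g (u' 0)) fun n => g (u' n)) (i + 1) =
        wpName θ (M (g (u 0)) fun n => g (u n)) (i + 1)
      rw [h0]
      exact if_congr hmem rfl rfl
  · rintro u _ hu rfl z hz w rfl q hq
    obtain rfl : z = M (g (u 0)) fun n => g (u n) :=
      (wpRep θ hθ).unique _ _ _ hz (name_wpName θ hθ _)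
    have hmem := Nat.sInf_mem (hne u hu q hq)
    have hconst := eq_of_testWord_notMem_radical hC (hanti u hu) hJ ((hgood_iff u q hq _).1 hmem)
    refine ⟨u (sInf (good u q)), ⟨fun n => hanti u hu n.le_succ, ?_⟩, rfl⟩
    refine le_antisymm (le_ciInf fun m => ?_) (ciInf_le' (fun n => g (u n)) _)
    rcases le_total (sInf (good u q)) m with h | h
    · exact (hconst m h).ge
    · exact hanti u hu h
  · rintro u q _ hu rfl z hz w rfl hq
    obtain rfl : z = M (g (u 0)) fun n => g (u n) :=
      (wpRep θ hθ).unique _ _ _ hz (name_wpName θ hθ _)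
    have hn := Nat.sInf_mem (hne u hu q hq)
    -- `B` bounds the positions of the test words of all times up to the answer.
    let B := (Finset.range (sInf (good u q) + 1)).sup (code (g (u 0)) fun n => g (u n))
    refine ⟨sInf (good u q) + B + 2, fun u' q' _ huu hqq => ?_⟩
    have hgood : ∀ n ≤ sInf (good u q), (n ∈ good u' q' ↔ n ∈ good u q) := by
      intro n hn
      have h0 : u' 0 = u 0 := huu 0 (by omega)
      have hagree : ∀ j ≤ n, g (u' j) = g (u j) := fun j hj => by rw [huu j (by omega)]
      have hcode : code (g (u' 0)) (fun n => g (u' n)) n =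
          code (g (u 0)) (fun n => g (u n)) n := by
        rw [h0]
        exact congrArg (idx _) (testWord_congr hC hagree)
      have hle : code (g (u 0)) (fun n => g (u n)) n ≤ B :=
        Finset.le_sup (f := code (g (u 0)) fun n => g (u n)) (Finset.mem_range.2 (by omega))
      refine or_congr ?_ ?_
      · rw [hagree n le_rfl]
      · rw [hcode, hqq _ (by omega)]
    have hn' := (hgood _ le_rfl).2 hn
    have hle : sInf (good u' q') ≤ sInf (good u q) := Nat.sInf_le hn'
    have hge : sInf (good u q) ≤ sInf (good u' q') :=
      Nat.sInf_le ((hgood _ hle).1 (Nat.sInf_mem ⟨_, hn'⟩))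
    funext i
    change u' (sInf (good u' q')) = u (sInf (good u q))
    rw [le_antisymm hle hge, huu _ (by omega)]

end Lower

theorem mainTheorem7 (θ : ∀ k : ℕ, ℕ → FreeGroup (Fin k))
    (hθ : ∀ k, Function.Surjective (θ k))
    (C : Set GrpCat.{u}) (hfg : ∀ G ∈ C, Group.FG G) (hC : EquationallyNoetherian C) :
    (∃ f, EnumeratesOrdinal f (residualRank C hC)) ∧
    (residualRank C hC ≤ Ordinal.omega0 ^ Ordinal.omega0 →
      ∀ f, EnumeratesOrdinal f (residualRank C hC) →
        WeihrauchEquiv (resProblem θ hθ C) (limDescending f)) ∧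
    (Ordinal.omega0 ^ Ordinal.omega0 < residualRank C hC →
      (∃ g, EnumeratesOrdinal g (Ordinal.omega0 ^ Ordinal.omega0)) ∧
      (∀ g, EnumeratesOrdinal g (Ordinal.omega0 ^ Ordinal.omega0) →
        WeihrauchLE (limDescending g) (resProblem θ hθ C)) ∧
      (∀ f, EnumeratesOrdinal f (residualRank C hC) →
        WeihrauchLE (resProblem θ hθ C) (limDescending f))) := by
  have hlt : ∀ {α : Ordinal.{0}} {f : ℕ → Ordinal.{0}}, EnumeratesOrdinal f α → ∀ n, f n < α :=
    fun {_ f} h n => h.subset (Set.mem_range_self (f := f) n)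
  refine ⟨exists_enumeratesOrdinal hC (residualRank_pos hC) le_rfl, fun _ f hf =>
    ⟨resProblem_le_limDescending hC hf, limDescending_le_resProblem hC (hlt hf)⟩,
    fun hα => ⟨exists_enumeratesOrdinal hC (Ordinal.opow_pos _ Ordinal.omega0_pos) hα.le,
      fun g hg => limDescending_le_resProblem hC fun n => (hlt hg n).trans hα,
      fun f hf => resProblem_le_limDescending hC hf⟩⟩
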